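/- **Setting.** A single-input single-output (SISO) quantum linear system (QLS) with $n\ge 0$ modes and no static scattering or squeezing of the field is a pair $(C,\Omega)$ with $C=\Delta(C_-,C_+)$, $\Omega=\Delta(\Omega_-,\Omega_+)$, where $C_\pm\in\mathbb{C}^{1\times n}$, $\Omega_\pm\in\mathbb{C}^{n\times n}$, $\Omega_-=\Omega_-^\dagger$, $\Omega_+=\Omega_+^T$, and $\Delta(X,Y)=\begin{pmatrix}X&Y\\ \overline{Y}&\overline{X}\end{pmatrix}$ (entrywise conjugation). Let $J_k=\begin{pmatrix}1_k&0\\0&-1_k\end{pmatrix}$ and $Z^\flat=J_nZ^\dagger J_m$ for $Z\in\mathbb{C}^{2m\times 2n}$. The system matrix, the transfer function, and the power spectrum for the vacuum input covariance $V_{\mathrm{vac}}=\begin{pmatrix}1&0\\0&0\end{pmatrix}$ are $$A=-\tfrac12C^\flat C-iJ_n\Omega,\qquad \Xi(s)=1_2-C(s1_{2n}-A)^{-1}C^\flat=\begin{pmatrix}\Xi_-(s)&\Xi_+(s)\\ \overline{\Xi_+(\overline s)}&\overline{\Xi_-(\overline s)}\end{pmatrix},\qquad \Psi(s)=\Xi(s)\,V_{\mathrm{vac}}\,\Xi(-\overline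 s)^\dagger .$$ All systems are assumed to be (Hurwitz) stable: every eigenvalue of $A$ has negative real part. A system with $n$ modes is *globally minimal* (for the input $V_{\mathrm{vac}}$) if no stable SISO QLS with fewer than $n$ modes has the same power spectrum. It is *generic* if it admits a cascade realisation, that is, if its transfer function is that of a series product of $n$ one-mode SISO QLSs, $\Xi(s)=\Xi^{(n)}(s)\cdots\Xi^{(1)}(s)$ with each $\Xi^{(i)}$ the transfer function of a one-mode SISO QLS. Transfer functions and power spectra are rational functions of $s$; an identity "for all $s$" is meant for all $s\in\mathbb{C}$ at which the formulas defining its two sides make sense. **Theorem (Power spectrum identification of SISO QLSs).** Let $(C_1,\Omega_1)$ and $(C_2,\Omega_2)$ be two stable, generic SISO QLSs, possibly with different numbers of modes, which are globally minimal for the vacuum input $V_{\mathrm{vac}}$. Then $$\Psi_1(s)=\Psi_2(s)\ \text{ for all } s\quad\Longleftrightarrow\quad \Xi_1(s)=\Xi_2(s)\ \text{ for all } s.$$ -/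

import Mathlib

open Matrix

noncomputable section

namespace QuantumLinear

/-- The doubled-up matrix `Δ(X, Y)`: the block matrix with rows
`(X, Y)` and `(conj Y, conj X)`, where conjugation is entrywise. -/
def doubledUp {m n : Type*} (X Y : Matrix m n ℂ) : Matrix (m ⊕ m) (n ⊕ n) ℂ :=
  Matrix.fromBlocks X Y (Y.map (starRingEnd ℂ)) (X.map (starRingEnd ℂ))

/-- `J = diag(1, -1)` on a doubled-up space. -/
def J (n : Type*) [DecidableEq n] : Matrix (n ⊕ n) (n ⊕ n) ℂ :=
  Matrix.fromBlocks 1 0 0 (-1)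

/-- The symplectic adjoint `Z♭ = J Z† J`. -/
def flat {m n : Type*} [Fintype m] [DecidableEq m] [Fintype n] [DecidableEq n]
    (Z : Matrix (m ⊕ m) (n ⊕ n) ℂ) : Matrix (n ⊕ n) (m ⊕ m) ℂ :=
  J n * Zᴴ * J m

/-- The covariance matrix of the vacuum input. -/
def Vvac (m : Type*) [DecidableEq m] : Matrix (m ⊕ m) (m ⊕ m) ℂ :=
  Matrix.fromBlocks 1 0 0 0

/-- The data `(C, Ω)` of a quantum linear system with `m` field channels and `n` internal modes,
and no static scattering or squeezing of the field: the coupling operator is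
`L = C₋ a + C₊ a^#` and the Hamiltonian is
`H = a† Ω₋ a + ½ aᵀ Ω₊† a + ½ a† Ω₊ a^#`. -/
structure QLS (m n : ℕ) where
  Cminus : Matrix (Fin m) (Fin n) ℂ
  Cplus : Matrix (Fin m) (Fin n) ℂ
  Ωminus : Matrix (Fin n) (Fin n) ℂ
  Ωplus : Matrix (Fin n) (Fin n) ℂ
  isHermitian_Ωminus : Ωminus.IsHermitian
  isSymm_Ωplus : Ωplus.IsSymm

namespace QLS

variable {m n : ℕ}

/-- The doubled-up coupling matrix `C = Δ(C₋, C₊)`. -/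
def C (G : QLS m n) : Matrix (Fin m ⊕ Fin m) (Fin n ⊕ Fin n) ℂ :=
  doubledUp G.Cminus G.Cplus

/-- The doubled-up Hamiltonian matrix `Ω = Δ(Ω₋, Ω₊)`. -/
def Ω (G : QLS m n) : Matrix (Fin n ⊕ Fin n) (Fin n ⊕ Fin n) ℂ :=
  doubledUp G.Ωminus G.Ωplus

/-- The system matrix `A = -½ C♭ C - i J Ω`. -/
def A (G : QLS m n) : Matrix (Fin n ⊕ Fin n) (Fin n ⊕ Fin n) ℂ :=
  (-(1 / 2 : ℂ)) • (flat G.C * G.C) - Complex.I • (J (Fin n) * G.Ω)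

/-- Hurwitz stability: all eigenvalues of `A` lie in the open left half plane. -/
def IsStable (G : QLS m n) : Prop :=
  ∀ z ∈ spectrum ℂ G.A, z.re < 0

/-- The transfer function `Ξ(s) = 1 - C (s - A)⁻¹ C♭`, meaningful for `s ∉ spectrum ℂ A`. -/
def transferFunction (G : QLS m n) (s : ℂ) : Matrix (Fin m ⊕ Fin m) (Fin m ⊕ Fin m) ℂ :=
  1 - G.C * (s • (1 : Matrix (Fin n ⊕ Fin n) (Fin n ⊕ Fin n) ℂ) - G.A)⁻¹ * flat G.C

/-- The power spectrum `Ψ_V(s) = Ξ(s) V Ξ(-s̄)†` for the input covariance `V`, meaningful when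
neither `s` nor `-s̄` is an eigenvalue of `A`. -/
def powerSpectrum (G : QLS m n) (V : Matrix (Fin m ⊕ Fin m) (Fin m ⊕ Fin m) ℂ) (s : ℂ) :
    Matrix (Fin m ⊕ Fin m) (Fin m ⊕ Fin m) ℂ :=
  G.transferFunction s * V * (G.transferFunction (-(starRingEnd ℂ s)))ᴴ

/-- The transfer functions of the two systems agree at every `s` at which both are defined. -/
def SameTransferFunction {n₁ n₂ : ℕ} (G₁ : QLS m n₁) (G₂ : QLS m n₂) : Prop :=
  ∀ s : ℂ, s ∉ spectrum ℂ G₁.A → s ∉ spectrum ℂ G₂.A →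
    G₁.transferFunction s = G₂.transferFunction s

/-- The power spectra of the two systems agree at every `s` at which both are defined. -/
def SamePowerSpectrum {n₁ n₂ : ℕ} (V : Matrix (Fin m ⊕ Fin m) (Fin m ⊕ Fin m) ℂ)
    (G₁ : QLS m n₁) (G₂ : QLS m n₂) : Prop :=
  ∀ s : ℂ, s ∉ spectrum ℂ G₁.A → -(starRingEnd ℂ s) ∉ spectrum ℂ G₁.A →
    s ∉ spectrum ℂ G₂.A → -(starRingEnd ℂ s) ∉ spectrum ℂ G₂.A →
    G₁.powerSpectrum V s = G₂.powerSpectrum V s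

/-- Global minimality for the input covariance `V`: no (stable) system with fewer modes has the
same power spectrum. -/
def IsGloballyMinimal (V : Matrix (Fin m ⊕ Fin m) (Fin m ⊕ Fin m) ℂ) (G : QLS m n) : Prop :=
  ∀ n' : ℕ, n' < n → ∀ G' : QLS m n', G'.IsStable → ¬ SamePowerSpectrum V G' G

/-- The transfer function is that of a cascade (series product) of `n` one-mode systems. In a
series product the transfer functions multiply, the leftmost factor being the system passed
last. -/
def HasCascadeRealisation (G : QLS m n) : Prop :=
  ∃ K : Fin n → QLS m 1, ∀ s : ℂ, s ∉ spectrum ℂ G.A → (∀ i, s ∉ spectrum ℂ (K i).A) →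
    G.transferFunction s = (List.ofFn fun i => (K i).transferFunction s).prod

end QLS

end QuantumLinear

end

/-! Only the implication from power spectra to transfer functions needs work.

The transfer function of one mode has numerators that are even in `s` over a real quadratic
denominator. Evenness survives doubled-up products, so a cascade of `n` modes has `Ξ = (a, b; b#,
a#) / D`, where `#` conjugates coefficients, `a` and `b` are even, `a` is monic of degree `2n`, `b`
has lower degree, `D` is real and monic of degree `2n`, and `a a# - b b# = D(s) D(-s)`
(`IsCascadeData`). By evenness the reflection `s ↦ -s` in the definition of `Ψ` does not affect the
numerators: `D(s) D(-s) Ψ(s)` is the product of the column `(a, b#)` and the row `(a#, b)`.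

If `a#` and `b` are coprime, then so are `a` and `b#`, and no factor of `D(s) D(-s)` divides all
four products. Hence `Ψ` determines `D(s) D(-s)`, then `a` and `b` by divisibility, and finally `D`,
whose roots lie in the left half plane (`IsCascadeData.eq_of_powerSpectrum`).

Coprimality comes from global minimality. By the norm identity and evenness, a common root of `a#`
and `b` yields, up to sign, a common root with `D`, so the second column of `Ξ` has a denominator of
degree below `2n`. Stability forces observability, so the second input fails to control the system,
and some left eigenvector `w` of `A` is not driven by it (`IsGloballyMinimal.two_mul_le_natDegree`).
Then `w` and its conjugate span a passive mode at the input. It multiplies the vacuum column of `Ξ`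
by an all-pass factor, which `Ψ` does not see, and compressing to a symplectic complement gives a
stable system with one mode less and the same `Ψ` (`exists_compress_samePowerSpectrum`). -/

noncomputable section

namespace QuantumLinear

/-! ### Doubled-up matrices and the symplectic adjoint. -/

section DoubledUp

variable {m n p : Type*}

/-- The antilinear involution `Z ↦ Σ conj(Z) Σ`, whose fixed points are the doubled-up matrices. -/
def swapConj (Z : Matrix (m ⊕ m) (n ⊕ n) ℂ) : Matrix (m ⊕ m) (n ⊕ n) ℂ :=
  (Z.map (starRingEnd ℂ)).submatrix Sum.swap Sum.swap

lemma swapConj_apply (Z : Matrix (m ⊕ m) (n ⊕ n) ℂ) (i : m ⊕ m) (j : n ⊕ n) :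
    swapConj Z i j = starRingEnd ℂ (Z i.swap j.swap) := rfl

lemma swapConj_doubledUp (X Y : Matrix m n ℂ) : swapConj (doubledUp X Y) = doubledUp X Y := by
  ext i j
  rcases i with i | i <;> rcases j with j | j <;> simp [swapConj_apply, doubledUp]

lemma eq_doubledUp_of_swapConj {Z : Matrix (m ⊕ m) (n ⊕ n) ℂ} (h : swapConj Z = Z) :
    doubledUp Z.toBlocks₁₁ Z.toBlocks₁₂ = Z := by
  ext i j
  have hij := congrFun (congrFun h i) j
  rw [swapConj_apply] at hij
  rcases i with i | i <;> rcases j with j | j <;>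
    first | rfl | exact hij

lemma swapConj_sub (Z W : Matrix (m ⊕ m) (n ⊕ n) ℂ) :
    swapConj (Z - W) = swapConj Z - swapConj W := by
  ext i j; simp [swapConj_apply]

lemma swapConj_mul [Fintype n] (Z : Matrix (m ⊕ m) (n ⊕ n) ℂ) (W : Matrix (n ⊕ n) (p ⊕ p) ℂ) :
    swapConj (Z * W) = swapConj Z * swapConj W := by
  ext i j
  simp only [swapConj_apply, mul_apply, map_add, map_sum, map_mul, Fintype.sum_sum_type,
    Sum.swap_inl, Sum.swap_inr]
  rw [add_comm]

lemma swapConj_one [DecidableEq n] : swapConj (1 : Matrix (n ⊕ n) (n ⊕ n) ℂ) = 1 := by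
  ext i j
  rcases i with i | i <;> rcases j with j | j <;> simp [swapConj_apply, one_apply, apply_ite]

lemma swapConj_smul (r : ℂ) (Z : Matrix (m ⊕ m) (n ⊕ n) ℂ) :
    swapConj (r • Z) = starRingEnd ℂ r • swapConj Z := by
  ext i j; simp [swapConj_apply]

lemma swapConj_conjTranspose (Z : Matrix (m ⊕ m) (n ⊕ n) ℂ) :
    swapConj Zᴴ = (swapConj Z)ᴴ := by
  ext i j; simp [swapConj_apply]

lemma doubledUp_mul [Fintype n] (X Y : Matrix m n ℂ) (X' Y' : Matrix n p ℂ) :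
    doubledUp X Y * doubledUp X' Y' =
      doubledUp (X * X' + Y * Y'.map (starRingEnd ℂ)) (X * Y' + Y * X'.map (starRingEnd ℂ)) := by
  rw [← eq_doubledUp_of_swapConj (Z := doubledUp X Y * doubledUp X' Y')
    (by rw [swapConj_mul, swapConj_doubledUp, swapConj_doubledUp])]
  simp [doubledUp, fromBlocks_multiply]

lemma conjTranspose_J [DecidableEq n] : (J n)ᴴ = J n := by
  simp [J, fromBlocks_conjTranspose]

lemma swapConj_J [DecidableEq n] : swapConj (J n) = -J n := by
  ext i j
  rcases i with i | i <;> rcases j with j | j <;> simp [swapConj_apply, J, one_apply, apply_ite]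

variable [Fintype m] [DecidableEq m] [Fintype n] [DecidableEq n] [Fintype p] [DecidableEq p]

lemma J_mul_J : J n * J n = 1 := by
  simp [J, fromBlocks_multiply]

lemma swapConj_flat (Z : Matrix (m ⊕ m) (n ⊕ n) ℂ) :
    swapConj (flat Z) = flat (swapConj Z) := by
  simp [flat, swapConj_mul, swapConj_J, swapConj_conjTranspose]

lemma swapConj_nonsing_inv {Z : Matrix (n ⊕ n) (n ⊕ n) ℂ} (h : swapConj Z = Z)
    (hZ : IsUnit Z.det) : swapConj Z⁻¹ = Z⁻¹ := by
  symm
  apply inv_eq_right_inv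
  have h1 := swapConj_mul Z Z⁻¹
  rwa [mul_nonsing_inv _ hZ, swapConj_one, h, eq_comm] at h1

lemma flat_mul (Z : Matrix (m ⊕ m) (n ⊕ n) ℂ) (W : Matrix (n ⊕ n) (p ⊕ p) ℂ) :
    flat (Z * W) = flat W * flat Z := by
  have h : ∀ B : Matrix (n ⊕ n) (m ⊕ m) ℂ, J n * (J n * B) = B := fun B => by
    rw [← Matrix.mul_assoc, J_mul_J, Matrix.one_mul]
  simp only [flat, conjTranspose_mul, Matrix.mul_assoc, h]

lemma flat_flat (Z : Matrix (m ⊕ m) (n ⊕ n) ℂ) : flat (flat Z) = Z := by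
  have h : J m * (J m * (Z * (J n * J n))) = Z := by
    rw [← Matrix.mul_assoc, J_mul_J, J_mul_J, Matrix.one_mul, Matrix.mul_one]
  simpa only [flat, conjTranspose_mul, conjTranspose_J, conjTranspose_conjTranspose,
    Matrix.mul_assoc] using h

lemma flat_one : flat (1 : Matrix (n ⊕ n) (n ⊕ n) ℂ) = 1 := by
  simp [flat, J_mul_J]

lemma flat_sub (Z W : Matrix (m ⊕ m) (n ⊕ n) ℂ) : flat (Z - W) = flat Z - flat W := by
  simp [flat, Matrix.mul_sub, Matrix.sub_mul]

lemma flat_smul (r : ℂ) (Z : Matrix (m ⊕ m) (n ⊕ n) ℂ) :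
    flat (r • Z) = starRingEnd ℂ r • flat Z := by
  simp [flat]

lemma flat_doubledUp (X Y : Matrix m n ℂ) :
    flat (doubledUp X Y) = doubledUp Xᴴ (-Yᵀ) := by
  have h1 : ∀ X : Matrix m n ℂ, (X.map (starRingEnd ℂ))ᴴ = Xᵀ := fun X => by ext; simp
  have h2 : ∀ X : Matrix m n ℂ, Xᵀ.map (starRingEnd ℂ) = Xᴴ := fun X => by ext; simp
  have h3 : ∀ X : Matrix m n ℂ, Xᴴ.map (starRingEnd ℂ) = Xᵀ := fun X => by ext; simp
  have h4 : ∀ X : Matrix n m ℂ, (-X).map (starRingEnd ℂ) = -X.map (starRingEnd ℂ) :=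
    fun X => by ext; simp
  simp [flat, doubledUp, J, fromBlocks_conjTranspose, fromBlocks_multiply, h1, h2, h3, h4]

end DoubledUp

/-! ### Eigenvectors and the spectrum. -/

/-- Eigenvalues of a complex square matrix. -/
lemma mem_spectrum_of_mulVec {ι : Type*} [Fintype ι] [DecidableEq ι] {A : Matrix ι ι ℂ} {μ : ℂ}
    {v : ι → ℂ} (hv : v ≠ 0) (h : A *ᵥ v = μ • v) : μ ∈ spectrum ℂ A := by
  rw [spectrum.mem_iff]
  intro hu
  apply hv
  have hd : IsUnit (algebraMap ℂ (Matrix ι ι ℂ) μ - A).det := (isUnit_iff_isUnit_det _).1 hu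
  have h0 : (algebraMap ℂ (Matrix ι ι ℂ) μ - A) *ᵥ v = 0 := by
    rw [sub_mulVec, h, algebraMap_eq_diagonal]
    ext i
    simp [mulVec_diagonal]
  simpa [mulVec_mulVec, nonsing_inv_mul _ hd] using
    congrArg (fun x => (algebraMap ℂ (Matrix ι ι ℂ) μ - A)⁻¹ *ᵥ x) h0

lemma mem_spectrum_of_vecMul {ι : Type*} [Fintype ι] [DecidableEq ι] {A : Matrix ι ι ℂ} {μ : ℂ}
    {v : ι → ℂ} (hv : v ≠ 0) (h : v ᵥ* A = μ • v) : μ ∈ spectrum ℂ A := by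
  rw [spectrum.mem_iff]
  intro hu
  apply hv
  have hd : IsUnit (algebraMap ℂ (Matrix ι ι ℂ) μ - A).det := (isUnit_iff_isUnit_det _).1 hu
  have h0 : v ᵥ* (algebraMap ℂ (Matrix ι ι ℂ) μ - A) = 0 := by
    rw [vecMul_sub, h, algebraMap_eq_diagonal]
    ext i
    simp [vecMul_diagonal, mul_comm]
  simpa [vecMul_vecMul, mul_nonsing_inv _ hd] using
    congrArg (fun x => x ᵥ* (algebraMap ℂ (Matrix ι ι ℂ) μ - A)⁻¹) h0

lemma isUnit_det_of_notMem_spectrum {ι : Type*} [Fintype ι] [DecidableEq ι] {A : Matrix ι ι ℂ}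
    {s : ℂ} (h : s ∉ spectrum ℂ A) : IsUnit (s • (1 : Matrix ι ι ℂ) - A).det := by
  rw [spectrum.notMem_iff, Algebra.algebraMap_eq_smul_one] at h
  exact (isUnit_iff_isUnit_det _).1 h

/-- An invariant subspace that contains no eigenvector is zero. -/
lemma exists_eigenvector_of_invariant {V : Type*} [AddCommGroup V] [Module ℂ V]
    [FiniteDimensional ℂ V] (f : Module.End ℂ V) (S : Submodule ℂ V) (hS : ∀ x ∈ S, f x ∈ S)
    (h0 : S ≠ ⊥) : ∃ x ∈ S, x ≠ 0 ∧ ∃ μ : ℂ, f x = μ • x := by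
  have : Nontrivial S := Submodule.nontrivial_iff_ne_bot.2 h0
  obtain ⟨μ, hμ⟩ := Module.End.exists_eigenvalue (f.restrict hS)
  obtain ⟨x, hx⟩ := hμ.exists_hasEigenvector
  refine ⟨x, x.2, fun h => hx.2 (Subtype.ext h), μ, ?_⟩
  simpa using congrArg Subtype.val hx.apply_eq_smul

/-! ### Symmetries of the system matrix. -/

namespace QLS

variable {m n : ℕ} (G : QLS m n)

lemma swapConj_C : swapConj G.C = G.C := swapConj_doubledUp _ _

lemma swapConj_Ω : swapConj G.Ω = G.Ω := swapConj_doubledUp _ _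

lemma conjTranspose_Ω : G.Ωᴴ = G.Ω := by
  have h1 : G.Ωplusᵀ = G.Ωplus := G.isSymm_Ωplus
  have h2 : G.Ωminusᴴ = G.Ωminus := G.isHermitian_Ωminus
  have h3 : (G.Ωplus.map (starRingEnd ℂ))ᴴ = G.Ωplus := by
    conv_rhs => rw [← h1]
    ext; simp
  have h4 : (G.Ωminus.map (starRingEnd ℂ))ᴴ = G.Ωminus.map (starRingEnd ℂ) := by
    conv_rhs => rw [← h2]
    ext; simp
  have h5 : G.Ωplusᴴ = G.Ωplus.map (starRingEnd ℂ) := by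
    conv_rhs => rw [← h1]
    ext; simp
  simp [Ω, doubledUp, fromBlocks_conjTranspose, h2, h3, h4, h5]

lemma swapConj_A : swapConj G.A = G.A := by
  rw [A, swapConj_sub, swapConj_smul, swapConj_smul, swapConj_mul, swapConj_mul, swapConj_flat,
    swapConj_C, swapConj_Ω, swapConj_J]
  simp only [map_neg, map_div₀, map_one, map_ofNat, Complex.conj_I]
  simp

/-- Since `Ω` is Hermitian, `J Ω` is its own symplectic adjoint, so the Hamiltonian part of `A`
changes sign while the damping part is preserved. This is physical realisability, `A + A♭ + C♭ C =
0`, from which the balance identities below are derived. -/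
lemma flat_A : flat G.A = -G.A - flat G.C * G.C := by
  have h : flat (J (Fin n) * G.Ω) = J (Fin n) * G.Ω := by
    simp [flat, conjTranspose_J, conjTranspose_Ω, Matrix.mul_assoc, J_mul_J]
  rw [A, flat_sub, flat_smul, flat_smul, flat_mul, flat_flat, h]
  simp only [map_neg, map_div₀, map_one, map_ofNat, Complex.conj_I]
  module

variable {G}

/-- On the kernel of `C`, realisability gives `A♭ = -A`. An eigenvalue `μ` with an unobservable
eigenvector is thus accompanied by the eigenvalue `-conj μ`, and the two cannot both lie in the open
left half plane. -/
lemma IsStable.not_unobservable (hG : G.IsStable) {v : Fin n ⊕ Fin n → ℂ} {μ : ℂ} (hv : v ≠ 0)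
    (hA : G.A *ᵥ v = μ • v) (hC : G.C *ᵥ v = 0) : False := by
  have h1 : flat G.A *ᵥ v = (-μ) • v := by
    rw [flat_A, sub_mulVec, neg_mulVec, hA, ← mulVec_mulVec, hC]
    simp
  have h2 : G.Aᴴ *ᵥ (J (Fin n) *ᵥ v) = (-μ) • (J (Fin n) *ᵥ v) := by
    rw [← mulVec_smul, ← h1, flat]
    simp only [mulVec_mulVec, ← Matrix.mul_assoc, J_mul_J, Matrix.one_mul]
  have h3 : J (Fin n) *ᵥ v ≠ 0 := by
    intro h
    apply hv
    simpa [mulVec_mulVec, J_mul_J] using congrArg (fun x => J (Fin n) *ᵥ x) h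
  have h4 := mem_spectrum_of_mulVec h3 h2
  have h5 := hG _ (mem_spectrum_of_mulVec hv hA)
  rw [← star_eq_conjTranspose, spectrum.map_star] at h4
  have h6 := hG _ (Set.mem_star.1 h4)
  simp at h6
  linarith

end QLS

/-! ### Symplectic complements of one-mode frames. -/

section Completion

variable {n p q : Type*} [Fintype n] [DecidableEq n] [Fintype p] [DecidableEq p]

/-- A symplectic Householder reflection carrying one normalised frame to another. -/
lemma exists_flat_isometry {X E : Matrix (n ⊕ n) (p ⊕ p) ℂ} (hX : swapConj X = X)
    (hE : swapConj E = E) (hXX : flat X * X = 1) (hEE : flat E * E = 1)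
    (hdet : IsUnit (1 - flat X * E).det) :
    ∃ S : Matrix (n ⊕ n) (n ⊕ n) ℂ, swapConj S = S ∧ flat S * S = 1 ∧ S * E = X := by
  obtain ⟨K, hK⟩ : ∃ K, K = 1 - flat X * E := ⟨_, rfl⟩
  obtain ⟨Z, hZ⟩ : ∃ Z, Z = X - E := ⟨_, rfl⟩
  obtain ⟨M, hM⟩ : ∃ M, M = K⁻¹ := ⟨_, rfl⟩
  rw [← hK] at hdet
  have hKM : K * M = 1 := by rw [hM, mul_nonsing_inv _ hdet]
  have hMK : M * K = 1 := by rw [hM, nonsing_inv_mul _ hdet]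
  have hMK' : flat M * flat K = 1 := by rw [← flat_mul, hKM, flat_one]
  have hKs : swapConj K = K := by
    rw [hK, swapConj_sub, swapConj_one, swapConj_mul, swapConj_flat, hX, hE]
  have hMs : swapConj M = M := by rw [hM, swapConj_nonsing_inv hKs hdet]
  have hZs : swapConj Z = Z := by rw [hZ, swapConj_sub, hX, hE]
  have hZZ : flat Z * Z = K + flat K := by
    rw [hZ, hK]
    simp only [flat_sub, flat_one, flat_mul, flat_flat, Matrix.mul_sub, Matrix.sub_mul, hXX, hEE]
    abel
  have hZE : flat Z * E = -K := by
    rw [hZ, hK, flat_sub, Matrix.sub_mul, hEE]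
    abel
  -- The two Gram identities carry the reflection: `Z♭ Z = K + K♭` makes it an isometry, and `Z♭ E =
  -- -K` makes it send `E` to `E + Z = X`.
  refine ⟨1 - Z * M * flat Z, ?_, ?_, ?_⟩
  · rw [swapConj_sub, swapConj_one, swapConj_mul, swapConj_mul, swapConj_flat, hZs, hMs]
  · have h1 : flat M * (flat Z * Z) * M = flat M + M := by
      rw [hZZ, Matrix.mul_add, Matrix.add_mul, hMK', Matrix.mul_assoc, hKM, Matrix.mul_one,
        Matrix.one_mul]
    have h2 : Z * flat M * flat Z * (Z * M * flat Z) =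
        Z * flat M * flat Z + Z * M * flat Z := by
      calc _ = Z * (flat M * (flat Z * Z) * M) * flat Z := by simp only [Matrix.mul_assoc]
        _ = _ := by rw [h1, Matrix.mul_add, Matrix.add_mul]
    have h3 : flat (1 - Z * M * flat Z) = 1 - Z * flat M * flat Z := by
      rw [flat_sub, flat_one, flat_mul, flat_mul, flat_flat, Matrix.mul_assoc]
    rw [h3, Matrix.sub_mul, Matrix.mul_sub, Matrix.mul_sub, h2]
    simp only [Matrix.one_mul, Matrix.mul_one]
    abel
  · rw [Matrix.sub_mul, Matrix.mul_assoc, hZE, Matrix.mul_neg, Matrix.mul_assoc, hMK, hZ]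
    simp

omit [Fintype n] in
lemma doubledUp_one_zero : doubledUp (1 : Matrix n n ℂ) 0 = 1 := by
  simp [doubledUp, Matrix.map_one]

lemma flat_doubledUp_zero (a : Matrix n p ℂ) : flat (doubledUp a 0) = doubledUp aᴴ 0 := by
  rw [flat_doubledUp]; simp

omit [DecidableEq n] [Fintype p] [DecidableEq p] in
lemma doubledUp_zero_mul {r : Type*} (a : Matrix r n ℂ) (b : Matrix n p ℂ) :
    doubledUp a 0 * doubledUp b 0 = doubledUp (a * b) 0 := by
  rw [doubledUp_mul]; simp

omit [Fintype n] [DecidableEq n] [Fintype p] [DecidableEq p] in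
lemma doubledUp_zero_add (a b : Matrix n p ℂ) :
    doubledUp a 0 + doubledUp b 0 = doubledUp (a + b) 0 := by
  ext i j
  rcases i with i | i <;> rcases j with j | j <;> simp [doubledUp]

lemma det_fin_one_sum (Z : Matrix (Fin 1 ⊕ Fin 1) (Fin 1 ⊕ Fin 1) ℂ) :
    Z.det = Z (.inl 0) (.inl 0) * Z (.inr 0) (.inr 0) -
      Z (.inl 0) (.inr 0) * Z (.inr 0) (.inl 0) := by
  rw [← det_submatrix_equiv_self finSumFinEquiv.symm]
  exact det_fin_two _

/-- A normalised doubled-up frame of one mode has a symplectic complement. -/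
lemma exists_complement {k : ℕ} {X : Matrix (Fin (k + 1) ⊕ Fin (k + 1)) (Fin 1 ⊕ Fin 1) ℂ}
    (hX : swapConj X = X) (hXX : flat X * X = 1) :
    ∃ T : Matrix (Fin (k + 1) ⊕ Fin (k + 1)) (Fin k ⊕ Fin k) ℂ, swapConj T = T ∧
      flat T * T = 1 ∧ flat X * T = 0 ∧ T * flat T + X * flat X = 1 := by
  have hXs : ∀ i, X (.inr i) (.inr 0) = starRingEnd ℂ (X (.inl i) (.inl 0)) := fun i => by
    conv_lhs => rw [← hX]
    rfl
  have hflat : ∀ a i, flat X a (.inl i) = (J (Fin 1) a a) * starRingEnd ℂ (X (.inl i) a) := by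
    intro a i
    rcases a with a | a <;> fin_cases a <;>
      simp [flat, J, mul_apply, Fintype.sum_sum_type, fromBlocks, one_apply]
  have hflat' : ∀ a i, flat X a (.inr i) = -(J (Fin 1) a a) * starRingEnd ℂ (X (.inr i) a) := by
    intro a i
    rcases a with a | a <;> fin_cases a <;>
      simp [flat, J, mul_apply, Fintype.sum_sum_type, fromBlocks, one_apply]
  -- The normalisation says that the differences of squared norms sum to `1` over `j`, so one of
  -- them is positive.
  obtain ⟨j, hj⟩ : ∃ j, ‖X (.inr j) (.inl 0)‖ < ‖X (.inl j) (.inl 0)‖ := by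
    by_contra! hcon
    have h1 := congrFun (congrFun hXX (.inl 0)) (.inl 0)
    rw [mul_apply, Fintype.sum_sum_type, one_apply_eq, ← Finset.sum_add_distrib] at h1
    have h2 : ∀ j : Fin (k + 1), flat X (.inl 0) (.inl j) * X (.inl j) (.inl 0) +
        flat X (.inl 0) (.inr j) * X (.inr j) (.inl 0) =
        ((‖X (.inl j) (.inl 0)‖ ^ 2 - ‖X (.inr j) (.inl 0)‖ ^ 2 : ℝ) : ℂ) := by
      intro j
      rw [hflat, hflat']
      push_cast
      rw [← Complex.conj_mul', ← Complex.conj_mul']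
      simp [J]
      ring
    rw [Finset.sum_congr rfl fun j _ => h2 j] at h1
    have h3 : ∑ j, (‖X (.inl j) (.inl 0)‖ ^ 2 - ‖X (.inr j) (.inl 0)‖ ^ 2) = 1 := by
      exact_mod_cast h1
    have h4 : ∑ j, (‖X (.inl j) (.inl 0)‖ ^ 2 - ‖X (.inr j) (.inl 0)‖ ^ 2) ≤ 0 :=
      Finset.sum_nonpos fun j _ => sub_nonpos.2 (pow_le_pow_left₀ (norm_nonneg _) (hcon j) 2)
    linarith
  obtain ⟨u, hu⟩ : ∃ u, u = X (.inl j) (.inl 0) := ⟨_, rfl⟩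
  have hu0 : (‖u‖ : ℂ) ≠ 0 := by
    rw [hu]; exact_mod_cast ((norm_nonneg _).trans_lt hj).ne'
  -- The phase opposite to that of `u` makes the determinant below equal to `(1 + ‖u‖)² - ‖X (inr j)
  -- (inl 0)‖²`, which is positive by the choice of `j`.
  obtain ⟨g, hg⟩ : ∃ g : ℂ, g = -(u / ‖u‖) := ⟨_, rfl⟩
  have hgg : starRingEnd ℂ g * g = 1 := by
    rw [hg]
    simp only [map_neg, map_div₀, Complex.conj_ofReal]
    field_simp
    rw [Complex.conj_mul']
  have hug : starRingEnd ℂ u * g = -‖u‖ := by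
    rw [hg, mul_neg, mul_div_assoc', Complex.conj_mul']
    field_simp
  -- `a` is the `j`-th basis vector with phase `g`, and `b` includes the remaining coordinates. The
  -- isometry taking `a` to `X` takes `b` to the complement.
  let a : Matrix (Fin (k + 1)) (Fin 1) ℂ := Matrix.of fun i _ => if i = j then g else 0
  let b : Matrix (Fin (k + 1)) (Fin k) ℂ :=
    Matrix.of fun i l => if i = j.succAbove l then 1 else 0
  have haa : aᴴ * a = 1 := by
    ext i l
    fin_cases i; fin_cases l
    simp [a, mul_apply, apply_ite, hgg]
  have hab : aᴴ * b = 0 := by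
    ext i l
    simp [a, b, mul_apply]
  have hbb : bᴴ * b = 1 := by
    ext i l
    simp [b, mul_apply, one_apply, apply_ite, eq_comm]
  have hab' : b * bᴴ + a * aᴴ = 1 := by
    ext i l
    rw [Matrix.add_apply, mul_apply, mul_apply, one_apply]
    simp only [conjTranspose_apply, a, b, of_apply, Finset.univ_unique, Finset.sum_const,
      Finset.card_singleton, one_smul]
    rcases Fin.eq_self_or_eq_succAbove j i with hi | ⟨i', hi⟩ <;>
      rcases Fin.eq_self_or_eq_succAbove j l with hl | ⟨l', hl⟩
    · simp [hi, hl, mul_comm g, hgg]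
    · simp [hi, hl]
    · simp [hi, hl]
    · simp [hi, hl, apply_ite, eq_comm]
  have hdet : IsUnit (1 - flat X * doubledUp a 0).det := by
    have e1 : ∀ c, (flat X * doubledUp a 0) c (.inl 0) = flat X c (.inl j) * g := by
      intro c
      simp [mul_apply, Fintype.sum_sum_type, doubledUp, a]
    have e2 : ∀ c, (flat X * doubledUp a 0) c (.inr 0) =
        flat X c (.inr j) * starRingEnd ℂ g := by
      intro c
      simp [mul_apply, Fintype.sum_sum_type, doubledUp, a, apply_ite]
    have hXs' : X (.inl j) (.inr 0) = starRingEnd ℂ (X (.inr j) (.inl 0)) := by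
      conv_lhs => rw [← hX]
      rfl
    have e3 : (1 - flat X * doubledUp a 0).det =
        (((1 + ‖u‖) ^ 2 - ‖X (.inr j) (.inl 0)‖ ^ 2 : ℝ) : ℂ) := by
      have hug' : u * starRingEnd ℂ g = -‖u‖ := by
        simpa using congrArg (starRingEnd ℂ) hug
      rw [det_fin_one_sum]
      simp only [Matrix.sub_apply, e1, e2, hflat, hflat', hXs, hXs', J, fromBlocks_apply₁₁,
        fromBlocks_apply₂₂, one_apply_eq, Matrix.neg_apply, ← hu, Complex.conj_conj, one_mul,
        neg_neg, hug, hug']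
      push_cast
      rw [← Complex.conj_mul' (X _ _)]
      simp
      linear_combination (-(starRingEnd ℂ (X (.inr j) (.inl 0)) * X (.inr j) (.inl 0))) * hgg
    rw [e3, isUnit_iff_ne_zero]
    have : ‖X (.inr j) (.inl 0)‖ ^ 2 < (1 + ‖u‖) ^ 2 := by
      rw [← hu] at hj
      have := norm_nonneg (X (.inr j) (.inl 0))
      gcongr
      linarith
    exact_mod_cast (sub_pos.2 this).ne'
  obtain ⟨S, hSs, hSS, hSE⟩ := exists_flat_isometry hX (swapConj_doubledUp a 0) hXX
    (by rw [flat_doubledUp_zero, doubledUp_zero_mul, haa, doubledUp_one_zero]) hdet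
  have hSX : flat X * S = flat (doubledUp a 0) := by
    rw [← hSE, flat_mul, Matrix.mul_assoc, hSS, Matrix.mul_one]
  refine ⟨S * doubledUp b 0, ?_, ?_, ?_, ?_⟩
  · rw [swapConj_mul, hSs, swapConj_doubledUp]
  · rw [flat_mul, Matrix.mul_assoc, ← Matrix.mul_assoc (flat S), hSS, Matrix.one_mul,
      flat_doubledUp_zero, doubledUp_zero_mul, hbb, doubledUp_one_zero]
  · rw [← Matrix.mul_assoc, hSX, flat_doubledUp_zero, doubledUp_zero_mul, hab]
    simp [doubledUp]
  · have h1 : S * (doubledUp b 0 * flat (doubledUp b 0) + doubledUp a 0 * flat (doubledUp a 0)) *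
        flat S = 1 := by
      rw [flat_doubledUp_zero, flat_doubledUp_zero, doubledUp_zero_mul, doubledUp_zero_mul,
        doubledUp_zero_add, hab', doubledUp_one_zero, Matrix.mul_one, mul_eq_one_comm.1 hSS]
    rw [← h1, ← hSE, flat_mul, flat_mul]
    simp only [Matrix.mul_add, Matrix.add_mul, Matrix.mul_assoc]

end Completion

/-! ### Compressing a system and removing a passive input mode. -/

namespace QLS

variable {m n k : ℕ}

/-- The compression of a system along a doubled-up matrix `T`: `C ↦ C T`, `Ω ↦ T† Ω T`. -/
def compress (G : QLS m n) (T : Matrix (Fin n ⊕ Fin n) (Fin k ⊕ Fin k) ℂ)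
    (hT : swapConj T = T) : QLS m k where
  Cminus := (G.C * T).toBlocks₁₁
  Cplus := (G.C * T).toBlocks₁₂
  Ωminus := (Tᴴ * G.Ω * T).toBlocks₁₁
  Ωplus := (Tᴴ * G.Ω * T).toBlocks₁₂
  isHermitian_Ωminus := by
    have h : (Tᴴ * G.Ω * T)ᴴ = Tᴴ * G.Ω * T := by
      simp [conjTranspose_mul, conjTranspose_Ω, Matrix.mul_assoc]
    ext i j
    exact congrFun (congrFun h (.inl i)) (.inl j)
  isSymm_Ωplus := by
    have h : (Tᴴ * G.Ω * T)ᴴ = Tᴴ * G.Ω * T := by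
      simp [conjTranspose_mul, conjTranspose_Ω, Matrix.mul_assoc]
    have h' : swapConj (Tᴴ * G.Ω * T) = Tᴴ * G.Ω * T := by
      rw [swapConj_mul, swapConj_mul, swapConj_conjTranspose, hT, swapConj_Ω]
    ext i j
    have h1 := congrFun (congrFun h (.inl i)) (.inr j)
    have h2 := congrFun (congrFun h' (.inl j)) (.inr i)
    exact h2.symm.trans h1

variable {G : QLS m n} {T : Matrix (Fin n ⊕ Fin n) (Fin k ⊕ Fin k) ℂ} (hT : swapConj T = T)

lemma compress_C : (G.compress T hT).C = G.C * T :=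
  eq_doubledUp_of_swapConj (by rw [swapConj_mul, swapConj_C, hT])

lemma compress_Ω : (G.compress T hT).Ω = Tᴴ * G.Ω * T :=
  eq_doubledUp_of_swapConj (by
    rw [swapConj_mul, swapConj_mul, swapConj_conjTranspose, hT, swapConj_Ω])

lemma compress_A : (G.compress T hT).A = flat T * G.A * T := by
  have h : flat T * J (Fin n) = J (Fin k) * Tᴴ := by
    rw [flat, Matrix.mul_assoc, J_mul_J, Matrix.mul_one]
  rw [A, compress_C, compress_Ω, A, flat_mul, Matrix.mul_sub, Matrix.sub_mul]
  simp only [Matrix.mul_smul, Matrix.smul_mul, ← Matrix.mul_assoc, h]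

end QLS

lemma J_eq_diagonal (n : Type*) [DecidableEq n] :
    J n = diagonal (Sum.elim (fun _ => 1) (fun _ => -1)) := by
  ext i j
  rcases i with i | i <;> rcases j with j | j <;> simp [J, diagonal_apply, one_apply]
  split <;> simp

lemma flat_apply {m n : Type*} [Fintype m] [DecidableEq m] [Fintype n] [DecidableEq n]
    (Z : Matrix (m ⊕ m) (n ⊕ n) ℂ) (a : n ⊕ n) (b : m ⊕ m) :
    flat Z a b = J n a a * starRingEnd ℂ (Z b a) * J m b b := by
  rw [flat, J_eq_diagonal, J_eq_diagonal, mul_diagonal, diagonal_mul]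
  simp

/-- The matrix `diag(z, conj z)`. -/
def conjDiag (z : ℂ) : Matrix (Fin 1 ⊕ Fin 1) (Fin 1 ⊕ Fin 1) ℂ :=
  doubledUp (z • (1 : Matrix (Fin 1) (Fin 1) ℂ)) 0

lemma swapConj_conjDiag (z : ℂ) : swapConj (conjDiag z) = conjDiag z := swapConj_doubledUp _ _

lemma flat_conjDiag (z : ℂ) : flat (conjDiag z) = conjDiag (starRingEnd ℂ z) := by
  rw [conjDiag, flat_doubledUp_zero, conjTranspose_smul, conjTranspose_one]
  rfl

lemma conjDiag_mul (z w : ℂ) : conjDiag z * conjDiag w = conjDiag (z * w) := by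
  rw [conjDiag, conjDiag, conjDiag, doubledUp_zero_mul, smul_mul_smul_comm, Matrix.one_mul]

lemma conjDiag_eq_of_apply {Z : Matrix (Fin 1 ⊕ Fin 1) (Fin 1 ⊕ Fin 1) ℂ} (h : swapConj Z = Z)
    (h' : Z (.inl 0) (.inr 0) = 0) : Z = conjDiag (Z (.inl 0) (.inl 0)) := by
  rw [← eq_doubledUp_of_swapConj h, conjDiag]
  congr 1
  · ext i j
    fin_cases i; fin_cases j
    simp [toBlocks₁₁, doubledUp]
  · ext i j
    fin_cases i; fin_cases j
    exact h'

namespace QLS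

lemma powerSpectrum_apply {n : ℕ} (G : QLS 1 n) (s : ℂ) (i j : Fin 1 ⊕ Fin 1) :
    G.powerSpectrum (Vvac (Fin 1)) s i j = G.transferFunction s i (.inl 0) *
      starRingEnd ℂ (G.transferFunction (-(starRingEnd ℂ s)) j (.inl 0)) := by
  simp [powerSpectrum, Vvac, mul_apply, Fintype.sum_sum_type, fromBlocks]

/-- A stable system with a normalised decoupled passive input mode has the same vacuum power
spectrum as a stable system with one mode less. -/
lemma exists_compress_samePowerSpectrum {k : ℕ} {G : QLS 1 (k + 1)} (hG : G.IsStable)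
    {X : Matrix (Fin (k + 1) ⊕ Fin (k + 1)) (Fin 1 ⊕ Fin 1) ℂ} (hX : swapConj X = X)
    (hXX : flat X * X = 1) {lam c : ℂ}
    (hXA : flat X * G.A = conjDiag lam * flat X)
    (hCX : G.C * X = conjDiag c) :
    ∃ G' : QLS 1 k, G'.IsStable ∧ SamePowerSpectrum (Vvac (Fin 1)) G' G := by
  obtain ⟨T, hT, hTT, hXT, hTX⟩ := exists_complement hX hXX
  obtain ⟨G', hG'⟩ : ∃ G', G' = G.compress T hT := ⟨_, rfl⟩
  have hA' : G'.A = flat T * G.A * T := by rw [hG', compress_A]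
  have hC' : G'.C = G.C * T := by rw [hG', compress_C]
  -- The rows of `X♭` span a left invariant space that annihilates `T`, so the range of `T` is
  -- invariant under `A`.
  have hAT : G.A * T = T * G'.A := by
    calc G.A * T = (T * flat T + X * flat X) * (G.A * T) := by rw [hTX, Matrix.one_mul]
      _ = T * (flat T * G.A * T) + X * (flat X * G.A) * T := by
        simp only [Matrix.add_mul, Matrix.mul_assoc]
      _ = T * G'.A := by
        rw [hXA, hA', Matrix.mul_assoc X, Matrix.mul_assoc _ (flat X), hXT]; simp
  have hAX : flat G.A * X = X * conjDiag (starRingEnd ℂ lam) := by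
    have := congrArg flat hXA
    rwa [flat_mul, flat_mul, flat_flat, flat_conjDiag] at this
  have hAX' : -(G.A * X) = X * conjDiag (starRingEnd ℂ lam) + flat G.C * (G.C * X) := by
    rw [← hAX, flat_A, Matrix.sub_mul, Matrix.neg_mul, Matrix.mul_assoc]; abel
  -- Realisability restricted to the mode `X`: its damping equals its coupling to the field.
  have hc : lam + starRingEnd ℂ lam = -(starRingEnd ℂ c * c) := by
    have h1 : -(flat X * (G.A * X)) = conjDiag (starRingEnd ℂ lam) +
        flat (G.C * X) * (G.C * X) := by
      rw [← Matrix.mul_neg, hAX', Matrix.mul_add, ← Matrix.mul_assoc, hXX, flat_mul,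
        Matrix.one_mul, Matrix.mul_assoc]
    rw [← Matrix.mul_assoc, hXA, Matrix.mul_assoc, hXX, Matrix.mul_one, hCX,
      flat_conjDiag, conjDiag_mul] at h1
    have h2 := congrFun (congrFun h1 (.inl 0)) (.inl 0)
    simp [conjDiag, doubledUp] at h2
    linear_combination -h2
  have hlam : lam ∈ spectrum ℂ G.A := by
    refine mem_spectrum_of_vecMul (v := flat X (.inl 0)) ?_ ?_
    · intro h
      have := congrFun (congrFun hXX (.inl 0)) (.inl 0)
      rw [mul_apply, h] at this
      simp at this
    · ext j
      have := congrFun (congrFun hXA (.inl 0)) j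
      rw [mul_apply, mul_apply] at this
      simpa [vecMul, dotProduct, conjDiag, doubledUp, Fintype.sum_sum_type] using this
  -- Removing the mode multiplies the vacuum column by `1 + |c|² / (s + conj lam)`, which is the
  -- inverse of the all-pass factor of the mode by `hc`.
  have htf : ∀ s, s ∉ spectrum ℂ G.A → s ∉ spectrum ℂ G'.A → s + starRingEnd ℂ lam ≠ 0 →
      ∀ i, G'.transferFunction s i (.inl 0) =
        (s - lam) / (s + starRingEnd ℂ lam) * G.transferFunction s i (.inl 0) := by
    intro s hs hs' hsl i
    have hu := isUnit_det_of_notMem_spectrum hs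
    have hu' := isUnit_det_of_notMem_spectrum hs'
    obtain ⟨R, hR⟩ : ∃ R, R = (s • (1 : Matrix _ _ ℂ) - G.A)⁻¹ := ⟨_, rfl⟩
    obtain ⟨R', hR'⟩ : ∃ R', R' = (s • (1 : Matrix _ _ ℂ) - G'.A)⁻¹ := ⟨_, rfl⟩
    have hRA : R * (s • (1 : Matrix _ _ ℂ) - G.A) = 1 := by rw [hR, nonsing_inv_mul _ hu]
    have hRA' : (s • (1 : Matrix _ _ ℂ) - G'.A) * R' = 1 := by rw [hR', mul_nonsing_inv _ hu']
    have hTR : T * R' = R * T := by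
      calc T * R' = R * (s • (1 : Matrix _ _ ℂ) - G.A) * T * R' := by rw [hRA, Matrix.one_mul]
        _ = R * (T * (s • (1 : Matrix _ _ ℂ) - G'.A)) * R' := by
          rw [Matrix.mul_assoc R]
          congr 2
          simp [Matrix.sub_mul, Matrix.mul_sub, hAT]
        _ = R * T := by rw [← Matrix.mul_assoc, Matrix.mul_assoc (R * T), hRA', Matrix.mul_one]
    have h1 : G'.transferFunction s =
        G.transferFunction s + G.C * R * X * flat (G.C * X) := by
      have h2 : T * flat T = 1 - X * flat X := by rw [← hTX]; abel
      rw [transferFunction, transferFunction, ← hR, ← hR', hC', flat_mul, flat_mul]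
      calc 1 - G.C * T * R' * (flat T * flat G.C)
          = 1 - G.C * (T * R') * flat T * flat G.C := by simp only [Matrix.mul_assoc]
        _ = 1 - G.C * R * (T * flat T) * flat G.C := by rw [hTR]; simp only [Matrix.mul_assoc]
        _ = _ := by
          rw [h2]
          simp only [Matrix.mul_sub, Matrix.sub_mul, Matrix.mul_one, Matrix.mul_assoc]
          abel
    -- Realisability turns the action of `A` on `X` into a multiplication by `-conj lam` and a
    -- feedthrough `C♭ C X`, so the resolvent applied to `X` reproduces the transfer function.
    have h3 : G.C * R * X * (s • 1 + conjDiag (starRingEnd ℂ lam)) =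
        G.transferFunction s * (G.C * X) := by
      have h4 : R * (s • X - G.A * X) = X := by
        have := congrArg (fun Y => Y * X) hRA
        simpa [Matrix.mul_assoc, Matrix.sub_mul] using this
      have h5 : R * (s • X + X * conjDiag (starRingEnd ℂ lam)) =
          X - R * (flat G.C * (G.C * X)) := by
        rw [eq_sub_iff_add_eq, ← Matrix.mul_add, add_assoc, ← hAX', ← sub_eq_add_neg, h4]
      rw [transferFunction, ← hR, Matrix.sub_mul, Matrix.one_mul]
      calc _ = G.C * (R * (s • X + X * conjDiag (starRingEnd ℂ lam))) := by
            simp only [Matrix.mul_add, Matrix.mul_smul, Matrix.mul_one, Matrix.mul_assoc]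
        _ = _ := by rw [h5]; simp only [Matrix.mul_sub, Matrix.mul_assoc]
    rw [hCX] at h3
    rw [hCX, flat_conjDiag] at h1
    have h1i := congrFun (congrFun h1 i) (.inl 0)
    have h3i := congrFun (congrFun h3 i) (.inl 0)
    rw [Matrix.add_apply, mul_apply, Fintype.sum_sum_type] at h1i
    rw [mul_apply, mul_apply, Fintype.sum_sum_type, Fintype.sum_sum_type] at h3i
    simp [conjDiag, doubledUp] at h1i h3i
    rw [h1i, div_mul_eq_mul_div, eq_div_iff hsl]
    linear_combination starRingEnd ℂ c * h3i + G.transferFunction s i (.inl 0) * hc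
  refine ⟨G', ?_, ?_⟩
  · intro z hz
    rw [← spectrum_toLin', ← Module.End.hasEigenvalue_iff_mem_spectrum] at hz
    obtain ⟨v, hv⟩ := hz.exists_hasEigenvector
    have hv' : G'.A *ᵥ v = z • v := by simpa using hv.apply_eq_smul
    refine hG z (mem_spectrum_of_mulVec (v := T *ᵥ v) ?_ ?_)
    · intro h
      apply hv.2
      simpa [mulVec_mulVec, hTT] using congrArg (fun x => flat T *ᵥ x) h
    · rw [mulVec_mulVec, hAT, ← mulVec_mulVec, hv', mulVec_smul]
  · intro s hs1 hs2 hs3 hs4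
    have h1 : s + starRingEnd ℂ lam ≠ 0 := by
      intro h
      apply hs4
      rw [eq_neg_of_add_eq_zero_left h]
      simpa using hlam
    have h2 : s - lam ≠ 0 := by
      intro h
      rw [sub_eq_zero.1 h] at hs3
      exact hs3 hlam
    have h3 : -(starRingEnd ℂ s) + starRingEnd ℂ lam ≠ 0 := by
      intro h
      apply h2
      have h' := congrArg (starRingEnd ℂ) h
      simp only [map_add, map_neg, Complex.conj_conj, map_zero] at h'
      linear_combination -h'
    ext i j
    -- The factor at `s` and the conjugate of the factor at `-conj s` are inverse to each other.
    rw [powerSpectrum_apply, powerSpectrum_apply, htf s hs3 hs1 h1, htf _ hs4 hs2 h3]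
    simp only [map_mul, map_div₀, map_sub, map_add, map_neg, Complex.conj_conj]
    have h4 : -s + lam ≠ 0 := fun h => h2 (by linear_combination -h)
    field_simp
    ring

/-- A stable system in which some left eigenvector of `A` is not driven by the second input
is not globally minimal for the vacuum input. -/
lemma IsGloballyMinimal.controllable {n : ℕ} {G : QLS 1 n} (hG : G.IsStable)
    (hmin : G.IsGloballyMinimal (Vvac (Fin 1))) {w : Fin n ⊕ Fin n → ℂ} {lam : ℂ} (hw : w ≠ 0)
    (hwA : w ᵥ* G.A = lam • w) (hwB : (w ᵥ* flat G.C) (.inr 0) = 0) : False := by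
  obtain _ | k := n
  · exact hw (Subsingleton.elim _ _)
  -- The conjugate of `w` with its halves swapped is a left eigenvector for `conj lam`; the two rows
  -- together form a doubled-up candidate mode.
  let R : Matrix (Fin 1 ⊕ Fin 1) (Fin (k + 1) ⊕ Fin (k + 1)) ℂ :=
    Matrix.of (Sum.elim (fun _ => w) (fun _ j => starRingEnd ℂ (w j.swap)))
  have hR : swapConj R = R := by
    ext i j
    rcases i with i | i <;> simp [swapConj_apply, R]
  have hRA : R * G.A = conjDiag lam * R := by
    have hA : swapConj G.A = G.A := G.swapConj_A
    have h1 : ∀ j, (R * G.A) (.inl 0) j = (conjDiag lam * R) (.inl 0) j := by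
      intro j
      have := congrFun hwA j
      simpa [vecMul, dotProduct, mul_apply, R, conjDiag, doubledUp] using this
    have h2 : swapConj (R * G.A) = R * G.A := by rw [swapConj_mul, hR, hA]
    have h3 : swapConj (conjDiag lam * R) = conjDiag lam * R := by
      rw [swapConj_mul, hR, swapConj_conjDiag]
    ext i j
    rcases i with i | i <;> fin_cases i
    · exact h1 j
    · rw [← h2, ← h3]
      exact congrArg (starRingEnd ℂ) (h1 j.swap)
  obtain ⟨r, hRB⟩ : ∃ r : ℂ, R * flat G.C = conjDiag r := by
    refine ⟨(w ᵥ* flat G.C) (.inl 0), ?_⟩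
    exact conjDiag_eq_of_apply (by rw [swapConj_mul, hR, swapConj_flat, swapConj_C]) hwB
  have hCR : G.C * flat R = conjDiag (starRingEnd ℂ r) := by
    have := congrArg flat hRB
    rwa [flat_mul, flat_flat, flat_conjDiag] at this
  -- A doubled-up 2 × 2 matrix fixed by `flat` is a real scalar: its off-diagonal entry equals its
  -- own negative and its diagonal entry equals its own conjugate.
  obtain ⟨p, hp⟩ : ∃ p : ℝ, R * flat R = (p : ℂ) • 1 := by
    have h1 : swapConj (R * flat R) = R * flat R := by rw [swapConj_mul, swapConj_flat, hR]
    have h2 : flat (R * flat R) = R * flat R := by rw [flat_mul, flat_flat]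
    have h3 := flat_apply (R * flat R)
    have h4 := h3 (.inl 0) (.inl 0)
    have h5 := h3 (.inl 0) (.inr 0)
    have h6 : (R * flat R) (.inr 0) (.inl 0) =
        starRingEnd ℂ ((R * flat R) (.inl 0) (.inr 0)) := congrFun (congrFun h1.symm _) _
    rw [h2] at h4 h5
    rw [h6, Complex.conj_conj] at h5
    simp only [J, fromBlocks_apply₁₁, fromBlocks_apply₂₂, one_apply_eq, Matrix.neg_apply, one_mul,
      mul_neg, mul_one] at h4 h5
    obtain ⟨p, hp⟩ := Complex.conj_eq_iff_real.1 h4.symm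
    refine ⟨p, ?_⟩
    rw [conjDiag_eq_of_apply h1 (CharZero.eq_neg_self_iff.1 h5), hp]
    ext i j
    rcases i with i | i <;> rcases j with j | j <;> fin_cases i <;> fin_cases j <;>
      simp [conjDiag, doubledUp]
  have hlam : lam.re < 0 := hG _ (mem_spectrum_of_vecMul hw hwA)
  have hARflat : flat G.A * flat R = flat R * conjDiag (starRingEnd ℂ lam) := by
    have := congrArg flat hRA
    rwa [flat_mul, flat_mul, flat_conjDiag] at this
  have hAR : -(G.A * flat R) =
      flat R * conjDiag (starRingEnd ℂ lam) + flat G.C * (G.C * flat R) := by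
    rw [← hARflat, flat_A, Matrix.sub_mul, Matrix.neg_mul, Matrix.mul_assoc]; abel
  -- A Lyapunov identity. With `lam.re < 0` it shows that `p` is positive as soon as `r ≠ 0`, so
  -- that the mode is of annihilation type and can be normalised.
  have hpr : p * (2 * lam.re) = -‖r‖ ^ 2 := by
    have h1 : -(R * (G.A * flat R)) = (p : ℂ) • conjDiag (starRingEnd ℂ lam) +
        R * flat G.C * (G.C * flat R) := by
      rw [← Matrix.mul_neg, hAR, Matrix.mul_add, ← Matrix.mul_assoc, hp, Matrix.mul_assoc]
      simp
    rw [← Matrix.mul_assoc, hRA, Matrix.mul_assoc, hp, hRB, hCR, conjDiag_mul] at h1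
    have h2 := congrFun (congrFun h1 (.inl 0)) (.inl 0)
    simp [conjDiag, doubledUp] at h2
    have h3 : (p : ℂ) * (lam + starRingEnd ℂ lam) = -(‖r‖ : ℂ) ^ 2 := by
      rw [← Complex.mul_conj']
      linear_combination -h2
    rw [Complex.add_conj] at h3
    exact_mod_cast h3
  -- If `r = 0`, the mode decouples from the field, and a column of `R♭` is an unobservable
  -- eigenvector of `A` for `-conj lam`.
  have hr : r ≠ 0 := by
    rintro rfl
    have hx : (flat R).col (.inl 0) ≠ 0 := by
      intro h
      apply hw
      ext j
      have h3 := flat_apply (flat R) (.inl 0) j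
      have h4 : flat R j (.inl 0) = 0 := congrFun h j
      rw [h4, map_zero, mul_zero, zero_mul] at h3
      rw [flat_flat] at h3
      exact h3
    refine hG.not_unobservable (μ := -(starRingEnd ℂ lam)) hx ?_ ?_
    · have h0 : conjDiag (starRingEnd ℂ 0) = 0 := by
        ext i j
        rcases i with i | i <;> rcases j with j | j <;> simp [conjDiag, doubledUp]
      rw [hCR, h0, Matrix.mul_zero, add_zero] at hAR
      ext i
      have h1 : (G.A * flat R) i (.inl 0) =
          -((flat R * conjDiag (starRingEnd ℂ lam)) i (.inl 0)) := by
        rw [← hAR]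
        exact (neg_neg _).symm
      rw [mul_apply (M := flat R), Fintype.sum_sum_type] at h1
      refine Eq.trans h1 ?_
      simp [conjDiag, doubledUp, mul_comm]
    · rw [← mulVec_single_one, mulVec_mulVec, hCR]
      ext i
      rcases i with i | i <;> simp [conjDiag, doubledUp]
  have hp0 : 0 < p := by
    have : 0 < ‖r‖ := norm_pos_iff.2 hr
    by_contra! h
    nlinarith
  have hsq : (((√p)⁻¹ : ℝ) : ℂ) * ((√p)⁻¹ : ℝ) * p = 1 := by
    have : (√p)⁻¹ * (√p)⁻¹ * p = 1 := by
      rw [← mul_inv, Real.mul_self_sqrt hp0.le, inv_mul_cancel₀ hp0.ne']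
    exact_mod_cast this
  obtain ⟨G', hG', hS⟩ := exists_compress_samePowerSpectrum hG
    (X := (((√p)⁻¹ : ℝ) : ℂ) • flat R) (lam := lam)
    (c := (((√p)⁻¹ : ℝ) : ℂ) * starRingEnd ℂ r)
    (by rw [swapConj_smul, swapConj_flat, hR, Complex.conj_ofReal])
    (by
      rw [flat_smul, flat_flat, Complex.conj_ofReal, Matrix.smul_mul, Matrix.mul_smul, hp,
        smul_smul, smul_smul, hsq, one_smul])
    (by rw [flat_smul, flat_flat, Matrix.smul_mul, hRA, Matrix.mul_smul])
    (by
      rw [Matrix.mul_smul, hCR]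
      ext i j
      rcases i with i | i <;> rcases j with j | j <;> simp [conjDiag, doubledUp, mul_assoc])
  exact hmin k (Nat.lt_succ_self k) G' hG' hS

end QLS

/-! ### The resolvent at infinity and polynomials in a matrix. -/

section Resolvent

open Filter Topology Bornology Polynomial

variable {ι : Type*} [Fintype ι] [DecidableEq ι]

lemma tendsto_resolvent_apply (A : Matrix ι ι ℂ) (i j : ι) :
    Tendsto (fun s : ℂ => (s • (1 : Matrix ι ι ℂ) - A)⁻¹ i j) (cobounded ℂ) (𝓝 0) := by
  let _ : NormedRing (Matrix ι ι ℂ) := Matrix.linftyOpNormedRing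
  let _ : NormedAlgebra ℂ (Matrix ι ι ℂ) := Matrix.linftyOpNormedAlgebra
  have h := spectrum.resolvent_tendsto_cobounded (𝕜 := ℂ) A
  have h1 : Tendsto (fun M : Matrix ι ι ℂ => M i j) (𝓝 0) (𝓝 0) :=
    (continuous_id.matrix_elem i j).tendsto' _ _ rfl
  refine (h1.comp h).congr fun s => ?_
  simp [resolvent, Algebra.algebraMap_eq_smul_one, nonsing_inv_eq_ringInverse]

lemma tendsto_mulVec_resolvent {κ : Type*} (A : Matrix ι ι ℂ) (C : Matrix κ ι ℂ) (x : ι → ℂ)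
    (i : κ) :
    Tendsto (fun s : ℂ => (C *ᵥ ((s • (1 : Matrix ι ι ℂ) - A)⁻¹ *ᵥ x)) i) (cobounded ℂ)
      (𝓝 0) := by
  have h : Tendsto (fun s : ℂ => ∑ j, C i j * ∑ k, (s • (1 : Matrix ι ι ℂ) - A)⁻¹ j k * x k)
      (cobounded ℂ) (𝓝 (∑ j, C i j * ∑ k, 0 * x k)) :=
    tendsto_finsetSum _ fun j _ => (tendsto_finsetSum _ fun k _ =>
      (tendsto_resolvent_apply A j k).mul_const _).const_mul _
  simpa [mulVec, dotProduct] using h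

lemma eq_zero_of_tendsto_cobounded {p : ℂ[X]}
    (h : Tendsto (fun s => p.eval s) (cobounded ℂ) (𝓝 0)) : p = 0 := by
  by_cases hd : 0 < p.degree
  · have h1 : Tendsto (fun s => ‖p.eval s‖) (cobounded ℂ) atTop :=
      p.tendsto_norm_atTop hd tendsto_norm_cobounded_atTop
    exact absurd h.norm (not_tendsto_nhds_of_tendsto_atTop h1 _)
  · rw [eq_C_of_degree_le_zero (not_lt.1 hd)] at h ⊢
    simp only [eval_C] at h
    rw [tendsto_const_nhds_iff.1 h, C_0]

/-- The quotient of `q(s) - q(A)` by `s - A` is polynomial in `s`. -/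
lemma exists_eval_sub_aeval_eq (A : Matrix ι ι ℂ) (q : ℂ[X]) :
    ∃ P : Matrix ι ι ℂ[X], ∀ s : ℂ, q.eval s • (1 : Matrix ι ι ℂ) - aeval A q =
      (s • (1 : Matrix ι ι ℂ) - A) * P.map (eval s) := by
  induction q using Polynomial.induction_on with
  | C a =>
    refine ⟨0, fun s => ?_⟩
    have h0 : (0 : Matrix ι ι ℂ[X]).map (eval s) = 0 := by ext; simp
    simp [h0, Algebra.algebraMap_eq_smul_one]
  | add p q hp hq =>
    obtain ⟨P, hP⟩ := hp
    obtain ⟨Q, hQ⟩ := hq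
    refine ⟨P + Q, fun s => ?_⟩
    have h0 : (P + Q).map (eval s) = P.map (eval s) + Q.map (eval s) := by ext; simp
    rw [h0, Matrix.mul_add, ← hP, ← hQ, eval_add, map_add, add_smul]
    abel
  | monomial k a h =>
    obtain ⟨P, hP⟩ := h
    -- For `f = a X^k`, the witness comes from `s f(s) - A f(A) = f(s) (s - A) + A (f(s) - f(A))`.
    refine ⟨(C a * X ^ k) • (1 : Matrix ι ι ℂ[X]) + A.map C * P, fun s => ?_⟩
    have h0 : ((C a * X ^ k) • (1 : Matrix ι ι ℂ[X]) + A.map C * P).map (eval s) =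
        (C a * X ^ k).eval s • (1 : Matrix ι ι ℂ) + A * P.map (eval s) := by
      ext i j
      simp [mul_apply, one_apply, eval_finsetSum, apply_ite (eval s)]
    have h1 : C a * X ^ (k + 1) = X * (C a * X ^ k) := by ring
    have h2 : (s • (1 : Matrix ι ι ℂ) - A) * (A * P.map (eval s)) =
        A * ((s • (1 : Matrix ι ι ℂ) - A) * P.map (eval s)) := by
      simp only [← Matrix.mul_assoc, Matrix.sub_mul, Matrix.mul_sub, Matrix.smul_mul,
        Matrix.mul_smul, Matrix.one_mul]
    rw [h0, h1, Matrix.mul_add, h2, ← hP, eval_mul, eval_X, map_mul, aeval_X]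
    simp only [Matrix.mul_sub, Matrix.mul_smul, Matrix.mul_one, mul_smul, smul_sub,
      smul_comm s]
    abel

end Resolvent

/-! ### Observability of stable systems. -/

namespace QLS

open Filter Topology Bornology Polynomial

variable {m n : ℕ} {G : QLS m n}

lemma eventually_notMem_spectrum {ι : Type*} [Fintype ι] [DecidableEq ι] (A : Matrix ι ι ℂ) :
    ∀ᶠ s in cofinite, s ∉ spectrum ℂ A :=
  A.finite_spectrum.compl_mem_cofinite

/-- A stable system is observable: no nonzero initial state has a vanishing output. -/
lemma IsStable.observable (hG : G.IsStable) {x : Fin n ⊕ Fin n → ℂ}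
    (hx : ∀ᶠ s in cobounded ℂ,
      G.C *ᵥ ((s • (1 : Matrix (Fin n ⊕ Fin n) (Fin n ⊕ Fin n) ℂ) - G.A)⁻¹ *ᵥ x) = 0) :
    x = 0 := by
  let R : ℂ → Matrix (Fin n ⊕ Fin n) (Fin n ⊕ Fin n) ℂ := fun s => (s • 1 - G.A)⁻¹
  let S : Submodule ℂ (Fin n ⊕ Fin n → ℂ) :=
    { carrier := {x | ∀ᶠ s in cobounded ℂ, G.C *ᵥ (R s *ᵥ x) = 0}
      add_mem' := fun {x y} hx hy => by
        change ∀ᶠ s in cobounded ℂ, G.C *ᵥ (R s *ᵥ (x + y)) = 0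
        filter_upwards [hx, hy] with s h1 h2
        rw [mulVec_add, mulVec_add, h1, h2, add_zero]
      zero_mem' := by simp
      smul_mem' := fun c x hx => by
        change ∀ᶠ s in cobounded ℂ, G.C *ᵥ (R s *ᵥ (c • x)) = 0
        filter_upwards [hx] with s h1
        rw [mulVec_smul, mulVec_smul, h1, smul_zero] }
  have hR : ∀ᶠ s in cobounded ℂ, ∀ x, R s *ᵥ (G.A *ᵥ x) = s • (R s *ᵥ x) - x := by
    filter_upwards [le_cofinite (α := ℂ) (eventually_notMem_spectrum G.A)] with s hs x
    have h1 := nonsing_inv_mul _ (isUnit_det_of_notMem_spectrum hs)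
    have h2 : R s * G.A = s • R s - 1 := by
      rw [← h1, Matrix.mul_sub, Matrix.mul_smul, Matrix.mul_one]
      simp [R]
    rw [mulVec_mulVec, h2, sub_mulVec, smul_mulVec, one_mulVec]
  -- For `x` in `S` the output of `A x` is eventually the constant `-C x`, and it tends to zero at
  -- infinity.
  have hC : ∀ x ∈ S, G.C *ᵥ x = 0 := by
    intro x hx
    ext i
    refine tendsto_nhds_unique (f := fun _ : ℂ => (G.C *ᵥ x) i) tendsto_const_nhds ?_
      (l := cobounded ℂ)
    have h1 := (tendsto_mulVec_resolvent G.A G.C (G.A *ᵥ x) i).neg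
    rw [neg_zero] at h1
    refine h1.congr' ?_
    filter_upwards [hR, hx] with s h1 h2
    have h3 := h1 x
    simp only [R] at h3 h2
    rw [h3, mulVec_sub, mulVec_smul, h2]
    simp
  have hA : ∀ x ∈ S, G.A *ᵥ x ∈ S := by
    intro x hx
    have h0 := hC x hx
    change ∀ᶠ s in cobounded ℂ, G.C *ᵥ (R s *ᵥ (G.A *ᵥ x)) = 0
    filter_upwards [hR, hx] with s h1 h2
    rw [h1, mulVec_sub, mulVec_smul, h2, h0]
    simp
  by_contra hx0
  have hS : S ≠ ⊥ := fun h => hx0 ((Submodule.eq_bot_iff S).1 h x hx)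
  obtain ⟨v, hv, hv0, μ, hμ⟩ := exists_eigenvector_of_invariant (toLin' G.A) S
    (by simpa using hA) hS
  exact hG.not_unobservable hv0 (by simpa using hμ) (hC v hv)

end QLS

open Polynomial in
/-- If a polynomial of degree less than the dimension maps the vector `b` to zero, then some
left eigenvector is orthogonal to `b`. -/
lemma exists_left_eigenvector {ι : Type*} [Fintype ι] [DecidableEq ι] (A : Matrix ι ι ℂ)
    (b : ι → ℂ) {q : ℂ[X]} (hq : q.Monic) (hqA : aeval A q *ᵥ b = 0)
    (hd : q.natDegree < Fintype.card ι) :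
    ∃ w : ι → ℂ, w ≠ 0 ∧ (∃ lam : ℂ, w ᵥ* A = lam • w) ∧ w ⬝ᵥ b = 0 := by
  -- `W` is the annihilator of the Krylov space of `b`. Modulo `q` that space is spanned by
  -- `natDegree q` vectors, too few to fill the whole space.
  let W : Submodule ℂ (ι → ℂ) :=
    { carrier := {w | ∀ f : ℂ[X], w ⬝ᵥ (aeval A f *ᵥ b) = 0}
      add_mem' := fun {x y} hx hy f => by rw [add_dotProduct, hx, hy, add_zero]
      zero_mem' := fun f => zero_dotProduct _
      smul_mem' := fun c x hx f => by rw [smul_dotProduct, hx, smul_zero] }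
  have hA : ∀ w ∈ W, w ᵥ* A ∈ W := by
    intro w hw f
    have := hw (X * f)
    rwa [map_mul, aeval_X, ← mulVec_mulVec, dotProduct_mulVec] at this
  let φ : (ι → ℂ) →ₗ[ℂ] (Fin q.natDegree → ℂ) :=
    { toFun := fun w k => w ⬝ᵥ ((A ^ (k : ℕ)) *ᵥ b)
      map_add' := fun x y => by ext k; simp [add_dotProduct]
      map_smul' := fun c x => by ext k; simp [smul_dotProduct] }
  have hker : LinearMap.ker φ ≠ ⊥ := LinearMap.ker_ne_bot_of_finrank_lt (by simpa using hd)
  have hW : W ≠ ⊥ := by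
    obtain ⟨w, hw, hw0⟩ := Submodule.exists_mem_ne_zero_of_ne_bot hker
    refine fun h => hw0 ((Submodule.eq_bot_iff W).1 h w fun f => ?_)
    have h1 : aeval A f *ᵥ b = aeval A (f %ₘ q) *ᵥ b := by
      conv_lhs => rw [← modByMonic_add_div f q]
      rw [map_add, add_mulVec, mul_comm, map_mul, ← mulVec_mulVec, hqA, mulVec_zero, add_zero]
    have h2 : (f %ₘ q).degree < q.natDegree := by
      rw [← degree_eq_natDegree hq.ne_zero]
      exact degree_modByMonic_lt _ hq
    rw [h1, aeval_def, eval₂_eq_sum, ← sum_fin _ (by simp) h2, sum_mulVec, dotProduct_sum]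
    refine Finset.sum_eq_zero fun k _ => ?_
    have h3 : w ⬝ᵥ ((A ^ (k : ℕ)) *ᵥ b) = 0 := congrFun (LinearMap.mem_ker.1 hw) k
    rw [← Algebra.smul_def, smul_mulVec, dotProduct_smul, h3, smul_zero]
  obtain ⟨w, hw, hw0, lam, hlam⟩ := exists_eigenvector_of_invariant A.vecMulLinear W
    (by simpa using hA) hW
  exact ⟨w, hw0, ⟨lam, by simpa using hlam⟩, by simpa using hw 1⟩

/-! ### Global minimality bounds the denominator of the second column. -/

namespace QLS

open Filter Topology Bornology Polynomial

/-- For a stable and globally minimal system, a common denominator of the second column of the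
transfer function has at least the degree of the system matrix. -/
lemma IsGloballyMinimal.two_mul_le_natDegree {n : ℕ} {G : QLS 1 n} (hG : G.IsStable)
    (hmin : G.IsGloballyMinimal (Vvac (Fin 1))) {q : ℂ[X]} (hq : q.Monic)
    {p : Fin 1 ⊕ Fin 1 → ℂ[X]}
    (h : ∀ᶠ s in cofinite, ∀ i,
      q.eval s * G.transferFunction s i (.inr 0) = (p i).eval s) :
    2 * n ≤ q.natDegree := by
  by_contra! hd
  obtain ⟨b, hb⟩ : ∃ b : Fin n ⊕ Fin n → ℂ, b = fun j => flat G.C j (.inr 0) := ⟨_, rfl⟩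
  have htf : ∀ s i, G.transferFunction s i (.inr 0) =
      (1 : Matrix (Fin 1 ⊕ Fin 1) (Fin 1 ⊕ Fin 1) ℂ) i (.inr 0) -
      (G.C *ᵥ ((s • (1 : Matrix (Fin n ⊕ Fin n) (Fin n ⊕ Fin n) ℂ) - G.A)⁻¹ *ᵥ b)) i := by
    intro s i
    rw [transferFunction, Matrix.sub_apply, mulVec_mulVec, hb]
    rfl
  obtain ⟨P, hP⟩ := exists_eval_sub_aeval_eq G.A q
  -- `r` is the output of the state `q(A) b`: replacing `q(A)` by `q(s) - (s - A) P(s)` cancels the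
  -- resolvent in the last term, and `q` clears the denominator in the first. A polynomial vanishing
  -- at infinity is zero, so observability yields `q(A) b = 0`.
  let r : Fin 1 ⊕ Fin 1 → ℂ[X] := fun i =>
    q * Polynomial.C ((1 : Matrix (Fin 1 ⊕ Fin 1) (Fin 1 ⊕ Fin 1) ℂ) i (.inr 0)) - p i -
      ∑ j, Polynomial.C (G.C i j) * ∑ k, P j k * Polynomial.C (b k)
  have hr : ∀ᶠ s in cobounded ℂ, ∀ i, (G.C *ᵥ ((s • (1 : Matrix (Fin n ⊕ Fin n) _ ℂ) - G.A)⁻¹ *ᵥ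
      (aeval G.A q *ᵥ b))) i = (r i).eval s := by
    filter_upwards [le_cofinite (α := ℂ) (eventually_notMem_spectrum G.A),
      le_cofinite (α := ℂ) h] with s hs h1 i
    have h2 := nonsing_inv_mul _ (isUnit_det_of_notMem_spectrum hs)
    have h3 : (s • (1 : Matrix (Fin n ⊕ Fin n) _ ℂ) - G.A)⁻¹ * aeval G.A q =
        q.eval s • (s • (1 : Matrix (Fin n ⊕ Fin n) _ ℂ) - G.A)⁻¹ - P.map (eval s) := by
      have h4 : aeval G.A q = q.eval s • (1 : Matrix (Fin n ⊕ Fin n) _ ℂ) -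
          (s • (1 : Matrix (Fin n ⊕ Fin n) _ ℂ) - G.A) * P.map (eval s) := by
        rw [← hP]; abel
      rw [h4, Matrix.mul_sub, ← Matrix.mul_assoc, h2, Matrix.one_mul, Matrix.mul_smul,
        Matrix.mul_one]
    have h5 := h1 i
    rw [htf] at h5
    rw [mulVec_mulVec b, h3, sub_mulVec, smul_mulVec, mulVec_sub, mulVec_smul, Pi.sub_apply,
      Pi.smul_apply, smul_eq_mul]
    simp only [r, eval_sub, eval_mul, eval_C, eval_finsetSum, ← h5]
    simp only [mulVec, dotProduct, map_apply]
    ring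
  have hr0 : ∀ i, r i = 0 := fun i => eq_zero_of_tendsto_cobounded
    ((tendsto_mulVec_resolvent G.A G.C (aeval G.A q *ᵥ b) i).congr'
      (hr.mono fun s hs => hs i))
  have hqb : aeval G.A q *ᵥ b = 0 := by
    refine hG.observable (hr.mono fun s hs => ?_)
    ext i
    rw [hs i, hr0 i]
    simp
  obtain ⟨w, hw0, ⟨lam, hw⟩, hwb⟩ := exists_left_eigenvector G.A b hq hqb
    (by simpa [two_mul] using hd)
  exact hmin.controllable hG hw0 hw (by rw [hb] at hwb; exact hwb)

end QLS

/-! ### Polynomial numerators and denominators of cascades. -/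

section CascadePolynomials

open Polynomial

lemma eval_map_conj (p : ℂ[X]) (s : ℂ) :
    (p.map (starRingEnd ℂ)).eval s = starRingEnd ℂ (p.eval (starRingEnd ℂ s)) := by
  rw [← coe_evalRingHom, ← coe_evalRingHom, ← RingHom.comp_apply, coe_evalRingHom, eval_map,
    RingHom.comp_apply, coe_evalRingHom, eval, hom_eval₂]
  simp

lemma map_conj_map_conj (p : ℂ[X]) : (p.map (starRingEnd ℂ)).map (starRingEnd ℂ) = p := by
  ext; simp

/-- The value at `s` of the doubled-up polynomial matrix with rows `(a, b)` and
`(conj b, conj a)`, where the coefficients are conjugated. -/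
def doubledUpEval (a b : ℂ[X]) (s : ℂ) : Matrix (Fin 1 ⊕ Fin 1) (Fin 1 ⊕ Fin 1) ℂ :=
  Matrix.of (Sum.elim
    (fun _ => Sum.elim (fun _ => a.eval s) (fun _ => b.eval s))
    (fun _ => Sum.elim (fun _ => (b.map (starRingEnd ℂ)).eval s)
      (fun _ => (a.map (starRingEnd ℂ)).eval s)))

lemma doubledUpEval_mul (a b a' b' : ℂ[X]) (s : ℂ) :
    doubledUpEval a b s * doubledUpEval a' b' s =
      doubledUpEval (a * a' + b * b'.map (starRingEnd ℂ))
        (a * b' + b * a'.map (starRingEnd ℂ)) s := by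
  ext i j
  rcases i with i | i <;> rcases j with j | j <;>
    simp [doubledUpEval, mul_apply, Fintype.sum_sum_type, eval_map_conj] <;> ring

/-- Numerators `a`, `b` and denominator `D` of a cascade of `k` one-mode systems with transfer
function `(a, b; conj b, conj a) / D`: the numerators are even, the denominator is real. -/
structure IsCascadeData (k : ℕ) (a b D : ℂ[X]) : Prop where
  monic_a : a.Monic
  natDegree_a : a.natDegree = 2 * k
  degree_b : b.degree < (2 * k : ℕ)
  even_a : a.comp (-X) = a
  even_b : b.comp (-X) = b
  monic_D : D.Monic
  natDegree_D : D.natDegree = 2 * k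
  real_D : D.map (starRingEnd ℂ) = D
  norm_eq : a * a.map (starRingEnd ℂ) - b * b.map (starRingEnd ℂ) = D * D.comp (-X)

namespace IsCascadeData

lemma one : IsCascadeData 0 1 0 1 where
  monic_a := monic_one
  natDegree_a := by simp
  degree_b := by simp
  even_a := by simp
  even_b := by simp
  monic_D := monic_one
  natDegree_D := by simp
  real_D := by simp
  norm_eq := by simp

variable {k l : ℕ} {a b D a' b' D' : ℂ[X]}

/-- The numerators multiply as doubled-up matrices, whose determinant `a a# - b b#` is
multiplicative; this gives the norm identity. The strict degree bound on `b` and `b'` keeps `a a'`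
the leading term. -/
lemma mul (h : IsCascadeData k a b D) (h' : IsCascadeData l a' b' D') :
    IsCascadeData (k + l) (a * a' + b * b'.map (starRingEnd ℂ))
      (a * b' + b * a'.map (starRingEnd ℂ)) (D * D') := by
  have hma : (a * a').Monic := h.monic_a.mul h'.monic_a
  have hda : (a * a').natDegree = 2 * (k + l) := by
    rw [h.monic_a.natDegree_mul h'.monic_a, h.natDegree_a, h'.natDegree_a]; ring
  have hda' : (a * a').degree = ((2 * (k + l) : ℕ) : WithBot ℕ) := by
    rw [degree_eq_natDegree hma.ne_zero, hda]
  have hea : a.degree = ((2 * k : ℕ) : WithBot ℕ) := by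
    rw [degree_eq_natDegree h.monic_a.ne_zero, h.natDegree_a]
  have hea' : (a'.map (starRingEnd ℂ)).degree = ((2 * l : ℕ) : WithBot ℕ) := by
    rw [degree_map, degree_eq_natDegree h'.monic_a.ne_zero, h'.natDegree_a]
  have hsum : ((2 * (k + l) : ℕ) : WithBot ℕ) = ((2 * k : ℕ) : WithBot ℕ) + (2 * l : ℕ) := by
    rw [← Nat.cast_add, mul_add]
  have hlt : ∀ {f g : ℂ[X]}, f.degree < ((2 * k : ℕ) : WithBot ℕ) →
      g.degree ≤ ((2 * l : ℕ) : WithBot ℕ) → (f * g).degree < ((2 * (k + l) : ℕ) : WithBot ℕ) := by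
    intro f g hf hg
    rw [degree_mul, hsum]
    exact (add_le_add_right hg _).trans_lt (WithBot.add_lt_add_right (WithBot.natCast_ne_bot _) hf)
  have hbb : (b * b'.map (starRingEnd ℂ)).degree < (a * a').degree := by
    rw [hda']
    exact hlt h.degree_b (by rw [degree_map]; exact h'.degree_b.le)
  refine ⟨hma.add_of_left hbb, ?_, ?_, ?_, ?_, h.monic_D.mul h'.monic_D, ?_, ?_, ?_⟩
  · rw [natDegree_eq_of_degree_eq (degree_add_eq_left_of_degree_lt hbb), hda]
  · refine (degree_add_le _ _).trans_lt (max_lt ?_ (hlt h.degree_b hea'.le))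
    rw [degree_mul, hea, hsum]
    exact WithBot.add_lt_add_left (WithBot.natCast_ne_bot _) h'.degree_b
  · have := h'.even_b
    simp only [add_comp, mul_comp, h.even_a, h.even_b, h'.even_a]
    rw [show (b'.map (starRingEnd ℂ)).comp (-X) = (b'.comp (-X)).map (starRingEnd ℂ) by
      simp [map_comp], this]
  · have := h'.even_a
    simp only [add_comp, mul_comp, h.even_a, h.even_b, h'.even_b]
    rw [show (a'.map (starRingEnd ℂ)).comp (-X) = (a'.comp (-X)).map (starRingEnd ℂ) by
      simp [map_comp], this]
  · rw [h.monic_D.natDegree_mul h'.monic_D, h.natDegree_D, h'.natDegree_D]; ring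
  · rw [Polynomial.map_mul, h.real_D, h'.real_D]
  · simp only [Polynomial.map_add, Polynomial.map_mul, map_conj_map_conj, mul_comp]
    linear_combination (a' * a'.map (starRingEnd ℂ) - b' * b'.map (starRingEnd ℂ)) * h.norm_eq +
      D * D.comp (-X) * h'.norm_eq

end IsCascadeData

namespace QLS

/-- The transfer function of a one-mode system has even numerators. -/
lemma exists_isCascadeData_one (K : QLS 1 1) : ∃ a b D : ℂ[X], IsCascadeData 1 a b D ∧
    ∀ s, s ∉ spectrum ℂ K.A → D.eval s • K.transferFunction s = doubledUpEval a b s := by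
  obtain ⟨c, hc⟩ : ∃ c, c = K.Cminus 0 0 := ⟨_, rfl⟩
  obtain ⟨d, hd⟩ : ∃ d, d = K.Cplus 0 0 := ⟨_, rfl⟩
  obtain ⟨w, hw⟩ : ∃ w, w = K.Ωminus 0 0 := ⟨_, rfl⟩
  obtain ⟨o, ho⟩ : ∃ o, o = K.Ωplus 0 0 := ⟨_, rfl⟩
  have hww : starRingEnd ℂ w = w := by
    rw [hw]; exact congrFun (congrFun K.isHermitian_Ωminus 0) 0
  obtain ⟨c', hc'⟩ : ∃ c', c' = starRingEnd ℂ c := ⟨_, rfl⟩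
  obtain ⟨d', hd'⟩ : ∃ d', d' = starRingEnd ℂ d := ⟨_, rfl⟩
  obtain ⟨o', ho'⟩ : ∃ o', o' = starRingEnd ℂ o := ⟨_, rfl⟩
  have hcc : starRingEnd ℂ c' = c := by rw [hc', Complex.conj_conj]
  have hdd : starRingEnd ℂ d' = d := by rw [hd', Complex.conj_conj]
  have hoo : starRingEnd ℂ o' = o := by rw [ho', Complex.conj_conj]
  -- `h` is the damping rate and `δ` the determinant of `Ω`, so that `det (s - A) = (s + h)² + δ`.
  -- As `C C♭ = 2h`, the terms linear in `s` cancel in the numerators, which are therefore even.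
  -- `μ`, `ν`, `ν'` enter their constant terms.
  obtain ⟨h, hh⟩ : ∃ h, h = (c * c' - d * d') / 2 := ⟨_, rfl⟩
  obtain ⟨δ, hδ⟩ : ∃ δ, δ = w ^ 2 - o * o' := ⟨_, rfl⟩
  obtain ⟨μ, hμ⟩ : ∃ μ, μ = (c * c' + d * d') * w - d * o' * c' - c * o * d' := ⟨_, rfl⟩
  obtain ⟨ν, hν⟩ : ∃ ν, ν = c ^ 2 * o + d ^ 2 * o' - 2 * c * d * w := ⟨_, rfl⟩
  obtain ⟨ν', hν'⟩ : ∃ ν', ν' = c' ^ 2 * o' + d' ^ 2 * o - 2 * c' * d' * w := ⟨_, rfl⟩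
  have hhc : starRingEnd ℂ h = h := by
    rw [hh]
    simp only [map_div₀, map_sub, map_mul, map_ofNat, ← hc', ← hd', hcc, hdd]
    ring
  have hδc : starRingEnd ℂ δ = δ := by
    rw [hδ]
    simp only [map_sub, map_mul, map_pow, ← ho', hoo, hww]
    ring
  have hμc : starRingEnd ℂ μ = μ := by
    rw [hμ]
    simp only [map_add, map_sub, map_mul, ← hc', ← hd', ← ho', hcc, hdd, hoo, hww]
    ring
  have hνc : starRingEnd ℂ ν = ν' := by
    rw [hν, hν']
    simp only [map_add, map_sub, map_mul, map_pow, map_ofNat, ← hc', ← hd', ← ho', hoo, hww]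
  have hI : Complex.I ^ 2 = -1 := Complex.I_sq
  have hCe : K.C = Matrix.of (Sum.elim (fun _ => Sum.elim (fun _ => c) (fun _ => d))
      (fun _ => Sum.elim (fun _ => d') (fun _ => c'))) := by
    ext i j
    rcases i with i | i <;> rcases j with j | j <;> fin_cases i <;> fin_cases j <;>
      simp [QLS.C, doubledUp, hc, hd, hc', hd']
  have hCf : flat K.C = Matrix.of (Sum.elim (fun _ => Sum.elim (fun _ => c') (fun _ => -d))
      (fun _ => Sum.elim (fun _ => -d') (fun _ => c))) := by
    ext i j
    rw [flat_apply, hCe]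
    rcases i with i | i <;> rcases j with j | j <;> fin_cases i <;> fin_cases j <;>
      simp [J, hcc, hdd, ← hc', ← hd']
  have hΩe : K.Ω = Matrix.of (Sum.elim (fun _ => Sum.elim (fun _ => w) (fun _ => o))
      (fun _ => Sum.elim (fun _ => o') (fun _ => w))) := by
    ext i j
    rcases i with i | i <;> rcases j with j | j <;> fin_cases i <;> fin_cases j <;>
      simp [QLS.Ω, doubledUp, ← hw, ← ho, ho', hww]
  have hAe : K.A = Matrix.of (Sum.elim
      (fun _ => Sum.elim (fun _ => -h - Complex.I * w) (fun _ => -(Complex.I * o)))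
      (fun _ => Sum.elim (fun _ => Complex.I * o') (fun _ => -h + Complex.I * w))) := by
    rw [QLS.A, hCf, hCe, hΩe, J_eq_diagonal]
    ext i j
    rcases i with i | i <;> rcases j with j | j <;> fin_cases i <;> fin_cases j <;>
      simp [mul_apply, Fintype.sum_sum_type, hh] <;> ring
  refine ⟨X ^ 2 + Polynomial.C (δ - h ^ 2 + Complex.I * μ), Polynomial.C (Complex.I * ν),
    (X + Polynomial.C h) ^ 2 + Polynomial.C δ, ?_, ?_⟩
  · have e1 : (δ - h ^ 2 + Complex.I * μ) + (δ - h ^ 2 - Complex.I * μ) = 2 * (δ - h ^ 2) := by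
      ring
    have e2 : (δ - h ^ 2 + Complex.I * μ) * (δ - h ^ 2 - Complex.I * μ) - ν * ν' =
        (h ^ 2 + δ) ^ 2 := by
      have e3 : μ ^ 2 - ν * ν' = 4 * h ^ 2 * δ := by
        rw [hμ, hν, hν', hh, hδ]; ring
      linear_combination e3 - μ ^ 2 * hI
    have hD : (X + Polynomial.C h) ^ 2 + Polynomial.C δ =
        X ^ 2 + (Polynomial.C (2 * h) * X + Polynomial.C (h ^ 2 + δ)) := by
      simp only [Polynomial.C_mul, Polynomial.C_add, Polynomial.C_pow, Polynomial.C_ofNat]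
      ring
    have hDdeg : (Polynomial.C (2 * h) * X + Polynomial.C (h ^ 2 + δ)).degree <
        ((2 : ℕ) : WithBot ℕ) :=
      degree_linear_le.trans_lt (by exact_mod_cast one_lt_two)
    refine ⟨monic_X_pow_add_C _ two_ne_zero, natDegree_X_pow_add_C,
      degree_C_le.trans_lt (by norm_num), by simp, by simp, ?_, ?_, ?_, ?_⟩
    · rw [hD]
      exact monic_X_pow_add hDdeg
    · rw [hD, natDegree_add_eq_left_of_degree_lt (by rwa [degree_X_pow]), natDegree_X_pow]
    · simp [hhc, hδc]
    · have f1 := congrArg (Polynomial.C (R := ℂ)) e1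
      have f2 := congrArg (Polynomial.C (R := ℂ)) e2
      have fI := congrArg (Polynomial.C (R := ℂ)) hI
      have m1 : starRingEnd ℂ (δ - h ^ 2 + Complex.I * μ) = δ - h ^ 2 - Complex.I * μ := by
        simp only [map_add, map_sub, map_mul, map_pow, Complex.conj_I, hhc, hδc, hμc]
        ring
      have m2 : starRingEnd ℂ (Complex.I * ν) = -(Complex.I * ν') := by
        rw [map_mul, Complex.conj_I, hνc, neg_mul]
      simp only [Polynomial.map_add, Polynomial.map_pow, map_X, map_C, m1, m2, add_comp, pow_comp,
        X_comp, C_comp]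
      simp only [map_add, map_sub, map_mul, map_pow, map_neg, map_one, map_ofNat] at f1 f2 fI ⊢
      linear_combination X ^ 2 * f1 + f2 + Polynomial.C ν * Polynomial.C ν' * fI
  · intro s hs
    obtain ⟨R, hR⟩ : ∃ R, R = (s • (1 : Matrix _ _ ℂ) - K.A)⁻¹ := ⟨_, rfl⟩
    have hRA : R * (s • (1 : Matrix _ _ ℂ) - K.A) = 1 := by
      rw [hR, nonsing_inv_mul _ (isUnit_det_of_notMem_spectrum hs)]
    -- `B` is the adjugate of `s - A`.
    obtain ⟨B, hB⟩ : ∃ B : Matrix (Fin 1 ⊕ Fin 1) (Fin 1 ⊕ Fin 1) ℂ, B = Matrix.of (Sum.elim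
      (fun _ => Sum.elim (fun _ => s + h - Complex.I * w) (fun _ => -(Complex.I * o)))
      (fun _ => Sum.elim (fun _ => Complex.I * o') (fun _ => s + h + Complex.I * w))) :=
      ⟨_, rfl⟩
    have hAB : (s • (1 : Matrix _ _ ℂ) - K.A) * B =
        ((s + h) ^ 2 + δ) • (1 : Matrix (Fin 1 ⊕ Fin 1) (Fin 1 ⊕ Fin 1) ℂ) := by
      rw [hAe, hB]
      ext i j
      rcases i with i | i <;> rcases j with j | j <;> fin_cases i <;> fin_cases j <;>
        simp [mul_apply, Fintype.sum_sum_type, hδ] <;> ring_nf <;> simp <;> ring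
    have hRB : ((s + h) ^ 2 + δ) • R = B := by
      have := congrArg (fun Y => R * Y) hAB
      simpa [← Matrix.mul_assoc, hRA] using this.symm
    have hD : ((X + Polynomial.C h) ^ 2 + Polynomial.C δ).eval s = (s + h) ^ 2 + δ := by simp
    rw [hD, transferFunction, ← hR, smul_sub, ← Matrix.smul_mul, ← Matrix.mul_smul, hRB, hCf,
      hCe, hB]
    ext i j
    rcases i with i | i <;> rcases j with j | j <;> fin_cases i <;> fin_cases j <;>
      simp [doubledUpEval, mul_apply, Fintype.sum_sum_type, hhc, hδc, hμc, hνc] <;>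
      simp only [hh, hμ, hν, hν'] <;> ring

lemma exists_isCascadeData_list (L : List (QLS 1 1)) : ∃ a b D : ℂ[X],
    IsCascadeData L.length a b D ∧ ∀ s, (∀ K ∈ L, s ∉ spectrum ℂ K.A) →
      D.eval s • (L.map fun K => K.transferFunction s).prod = doubledUpEval a b s := by
  induction L with
  | nil =>
    refine ⟨1, 0, 1, IsCascadeData.one, fun s _ => ?_⟩
    ext i j
    rcases i with i | i <;> rcases j with j | j <;> fin_cases i <;> fin_cases j <;>
      simp [doubledUpEval]
  | cons K L ih =>
    obtain ⟨a, b, D, h, hE⟩ := K.exists_isCascadeData_one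
    obtain ⟨a', b', D', h', hE'⟩ := ih
    refine ⟨_, _, _, by simpa [add_comm] using h.mul h', fun s hs => ?_⟩
    rw [List.map_cons, List.prod_cons, ← doubledUpEval_mul, ← hE s (hs K (by simp)),
      ← hE' s fun K' hK' => hs K' (by simp [hK']), eval_mul, smul_mul_smul_comm]

end QLS

end CascadePolynomials

/-! ### Recovering the cascade data from the power spectrum. -/

section Identification

open Polynomial Filter Topology

lemma continuousAt_transferFunction {m n : ℕ} (G : QLS m n) {s : ℂ} (hs : s ∉ spectrum ℂ G.A) :
    ContinuousAt G.transferFunction s := by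
  have h1 : Continuous fun z : ℂ => z • (1 : Matrix (Fin n ⊕ Fin n) (Fin n ⊕ Fin n) ℂ) - G.A :=
    (continuous_id.smul continuous_const).sub continuous_const
  have h2 : ContinuousAt
      (fun z : ℂ => (z • (1 : Matrix (Fin n ⊕ Fin n) (Fin n ⊕ Fin n) ℂ) - G.A)⁻¹) s := by
    simp only [inv_def, Ring.inverse_eq_inv']
    exact (h1.matrix_det.continuousAt.inv₀ (isUnit_det_of_notMem_spectrum hs).ne_zero).smul
      h1.matrix_adjugate.continuousAt
  have h3 : Continuous fun M : Matrix (Fin n ⊕ Fin n) (Fin n ⊕ Fin n) ℂ =>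
      1 - G.C * M * flat G.C :=
    continuous_const.sub ((continuous_const.matrix_mul continuous_id).matrix_mul continuous_const)
  exact h3.continuousAt.comp h2

/-- Cascade identities are first known off finitely many extra points, such as eigenvalues of the
one-mode factors or roots of `D`. Continuity removes these exceptions. -/
lemma eq_of_eventuallyEq_cofinite {Y : Type*} [TopologicalSpace Y] [T2Space Y] {f g : ℂ → Y}
    {s : ℂ} (hf : ContinuousAt f s) (hg : ContinuousAt g s) (h : ∀ᶠ z in cofinite, f z = g z) :
    f s = g s := by
  have h1 : ∀ᶠ z in 𝓝[≠] s, f z = g z := by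
    have h3 : IsClosed ({z | ¬f z = g z} \ {s}) := 
      ((mem_cofinite.1 h).subset fun z hz => hz.1).isClosed
    filter_upwards [nhdsWithin_le_nhds (h3.isOpen_compl.mem_nhds (x := s) (by simp)),
      self_mem_nhdsWithin] with z hz hzs
    by_contra hne
    exact hz ⟨hne, hzs⟩
  exact tendsto_nhds_unique (hf.tendsto.mono_left nhdsWithin_le_nhds |>.congr' h1)
    (hg.tendsto.mono_left nhdsWithin_le_nhds)

lemma continuous_doubledUpEval (a b : ℂ[X]) : Continuous (doubledUpEval a b) := by
  refine continuous_matrix fun i j => ?_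
  rcases i with i | i <;> rcases j with j | j <;> simp only [doubledUpEval, Matrix.of_apply,
    Sum.elim_inl, Sum.elim_inr] <;> exact Polynomial.continuous _

lemma isCoprime_of_forall_eval {p q : ℂ[X]} (h : ∀ z, p.eval z = 0 → q.eval z = 0 → False) :
    IsCoprime p q := by
  rw [isCoprime_iff_aeval_ne_zero_of_isAlgClosed ℂ ℂ]
  intro z
  by_contra! hz
  exact h z (by simpa using hz.1) (by simpa using hz.2)

lemma eval_eq_zero_of_even {p : ℂ[X]} (h : p.comp (-X) = p) {z : ℂ} (hz : p.eval z = 0) :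
    p.eval (-z) = 0 := by
  rw [← h] at hz
  simpa using hz

lemma eq_of_eventually_eval_eq {p q : ℂ[X]} (h : ∀ᶠ s in cofinite, p.eval s = q.eval s) :
    p = q :=
  eq_of_infinite_eval_eq p q (frequently_cofinite_iff_infinite.1 h.frequently)

lemma IsCascadeData.even_map_a {k : ℕ} {a b D : ℂ[X]} (h : IsCascadeData k a b D) :
    (a.map (starRingEnd ℂ)).comp (-X) = a.map (starRingEnd ℂ) := by
  conv_rhs => rw [← h.even_a]
  simp [map_comp]

namespace QLS

lemma HasCascadeRealisation.exists_isCascadeData {n : ℕ} {G : QLS 1 n}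
    (hgen : G.HasCascadeRealisation) : ∃ a b D : ℂ[X], IsCascadeData n a b D ∧
      ∀ s, s ∉ spectrum ℂ G.A → D.eval s • G.transferFunction s = doubledUpEval a b s := by
  obtain ⟨K, hK⟩ := hgen
  obtain ⟨a, b, D, h, hE⟩ := exists_isCascadeData_list (List.ofFn K)
  rw [List.length_ofFn] at h
  refine ⟨a, b, D, h, fun s hs => ?_⟩
  refine eq_of_eventuallyEq_cofinite
    (D.continuous.continuousAt.smul (continuousAt_transferFunction G hs))
    (continuous_doubledUpEval a b).continuousAt ?_
  filter_upwards [eventually_notMem_spectrum G.A,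
    eventually_all.2 fun i => eventually_notMem_spectrum (K i).A] with z hz hz'
  rw [Pi.smul_apply', hK z hz hz', ← hE z (by
    intro K' hK'
    obtain ⟨i, rfl⟩ := List.mem_ofFn.1 hK'
    exact hz' i), List.map_ofFn]
  rfl

variable {n : ℕ} {G : QLS 1 n} {a b D : ℂ[X]}

/-- For a stable and globally minimal system, the second column of the cascade data has no
common root with the denominator. -/
lemma IsGloballyMinimal.no_common_root (hG : G.IsStable)
    (hmin : G.IsGloballyMinimal (Vvac (Fin 1))) (h : IsCascadeData n a b D)
    (hE : ∀ s, s ∉ spectrum ℂ G.A → D.eval s • G.transferFunction s = doubledUpEval a b s)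
    {y : ℂ} (hD : D.eval y = 0) (ha : (a.map (starRingEnd ℂ)).eval y = 0) (hb : b.eval y = 0) :
    False := by
  obtain ⟨D', hD'⟩ := dvd_iff_isRoot.2 hD
  obtain ⟨a', ha'⟩ := dvd_iff_isRoot.2 ha
  obtain ⟨b', hb'⟩ := dvd_iff_isRoot.2 hb
  have hm : D'.Monic := (monic_X_sub_C y).of_mul_monic_left (hD' ▸ h.monic_D)
  have hdeg := h.natDegree_D
  rw [hD', (monic_X_sub_C y).natDegree_mul hm, natDegree_X_sub_C] at hdeg
  -- Cancelling `X - y` leaves the second column with a denominator of degree `2 * n - 1`, against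
  -- the lower bound `2 * n`.
  have := hmin.two_mul_le_natDegree hG hm (p := Sum.elim (fun _ => b') (fun _ => a')) (by
    filter_upwards [eventually_notMem_spectrum G.A, (Set.finite_singleton y).compl_mem_cofinite]
      with s hs hsy i
    have hsy' : s - y ≠ 0 := sub_ne_zero.2 hsy
    have h1 := congrFun (congrFun (hE s hs) i) (.inr 0)
    apply mul_left_cancel₀ hsy'
    rw [Matrix.smul_apply, hD', eval_mul, eval_sub, eval_X, eval_C, smul_eq_mul, mul_assoc] at h1
    rw [h1]
    rcases i with i | i
    · simp [doubledUpEval, hb']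
    · simp [doubledUpEval, ha'])
  omega

/-- By the norm identity, a common root `z` of `a#` and `b` makes `z` or `-z` a root of `D`. By
evenness `-z` is a common root as well, so either case gives a root shared with `D`. -/
lemma IsGloballyMinimal.isCoprime (hG : G.IsStable)
    (hmin : G.IsGloballyMinimal (Vvac (Fin 1))) (h : IsCascadeData n a b D)
    (hE : ∀ s, s ∉ spectrum ℂ G.A → D.eval s • G.transferFunction s = doubledUpEval a b s) :
    IsCoprime (a.map (starRingEnd ℂ)) b := by
  refine isCoprime_of_forall_eval fun z ha hb => ?_
  have h1 := congrArg (eval z) h.norm_eq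
  rw [eval_sub, eval_mul, eval_mul, ha, hb, mul_zero, zero_mul, sub_zero, eval_mul, eval_comp,
    eval_neg, eval_X, eq_comm, mul_eq_zero] at h1
  rcases h1 with h1 | h1
  · exact hmin.no_common_root hG h hE h1 ha hb
  · exact hmin.no_common_root hG h hE h1 (eval_eq_zero_of_even h.even_map_a ha)
      (eval_eq_zero_of_even h.even_b hb)

/-- The one-mode factors need not be stable, so the roots of `D` are not eigenvalues of `A` by
construction. But at a root outside the spectrum of `A` all numerators vanish, which minimality
excludes. -/
lemma IsGloballyMinimal.re_neg_of_isRoot (hG : G.IsStable)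
    (hmin : G.IsGloballyMinimal (Vvac (Fin 1))) (h : IsCascadeData n a b D)
    (hE : ∀ s, s ∉ spectrum ℂ G.A → D.eval s • G.transferFunction s = doubledUpEval a b s)
    {z : ℂ} (hz : D.eval z = 0) : z.re < 0 := by
  by_contra hre
  have h1 := hE z fun hs => hre (hG z hs)
  rw [hz, zero_smul] at h1
  exact hmin.no_common_root hG h hE hz (congrFun (congrFun h1 (.inr 0)) (.inr 0)).symm
    (congrFun (congrFun h1 (.inl 0)) (.inr 0)).symm

/-- Conjugating at `-conj s` amounts to conjugating coefficients and replacing `s` by `-s`. The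
numerators are even, so only the denominator is reflected. -/
lemma eval_mul_powerSpectrum (h : IsCascadeData n a b D)
    (hE : ∀ s, s ∉ spectrum ℂ G.A → D.eval s • G.transferFunction s = doubledUpEval a b s)
    {s : ℂ} (hs : s ∉ spectrum ℂ G.A) (hs' : -(starRingEnd ℂ s) ∉ spectrum ℂ G.A)
    (i j : Fin 1 ⊕ Fin 1) :
    (D * D.comp (-X)).eval s * G.powerSpectrum (Vvac (Fin 1)) s i j =
      (Sum.elim (fun _ => a) (fun _ => b.map (starRingEnd ℂ)) i *
        Sum.elim (fun _ => a.map (starRingEnd ℂ)) (fun _ => b) j : ℂ[X]).eval s := by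
  have h1 := congrFun (congrFun (hE _ hs) i) (.inl 0)
  have h2 := congrArg (starRingEnd ℂ) (congrFun (congrFun (hE _ hs') j) (.inl 0))
  have hD : starRingEnd ℂ (D.eval (-(starRingEnd ℂ s))) = (D.comp (-X)).eval s := by
    conv_rhs => rw [← h.real_D]
    rw [eval_comp, eval_map_conj]
    simp
  have ha : starRingEnd ℂ (a.eval (-(starRingEnd ℂ s))) = (a.map (starRingEnd ℂ)).eval s := by
    conv_rhs => rw [← h.even_map_a]
    rw [eval_comp, eval_map_conj]
    simp
  have hb : starRingEnd ℂ ((b.map (starRingEnd ℂ)).eval (-(starRingEnd ℂ s))) = b.eval s := by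
    conv_rhs => rw [← h.even_b]
    rw [eval_comp, eval_map_conj]
    simp
  rw [Matrix.smul_apply, smul_eq_mul] at h1 h2
  rw [map_mul, hD] at h2
  rw [powerSpectrum_apply, eval_mul, eval_mul]
  have h3 : doubledUpEval a b s i (.inl 0) =
      (Sum.elim (fun _ => a) (fun _ => b.map (starRingEnd ℂ)) i : ℂ[X]).eval s := by
    rcases i with i | i <;> rfl
  have h4 : starRingEnd ℂ (doubledUpEval a b (-(starRingEnd ℂ s)) j (.inl 0)) =
      (Sum.elim (fun _ => a.map (starRingEnd ℂ)) (fun _ => b) j : ℂ[X]).eval s := by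
    rcases j with j | j
    · exact ha
    · exact hb
  rw [← h3, ← h4, ← h1, ← h2]
  ring

end QLS

/-- A common divisor of `y * p` and `y * q` divides `y` if `p` and `q` are coprime. -/
lemma dvd_of_dvd_mul_of_isCoprime {R : Type*} [CommRing R] {x y p q : R} (hc : IsCoprime p q)
    (hp : x ∣ y * p) (hq : x ∣ y * q) : x ∣ y := by
  obtain ⟨u, v, huv⟩ := hc
  have h : y = u * (y * p) + v * (y * q) := by linear_combination -y * huv
  rw [h]
  exact dvd_add (hp.mul_left _) (hq.mul_left _)

lemma monic_comp_neg_X {D : ℂ[X]} {k : ℕ} (hD : D.Monic) (hd : D.natDegree = 2 * k) :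
    (D.comp (-X)).Monic := by
  rw [Monic, leadingCoeff_comp (by simp), hD.leadingCoeff, hd]
  simp

/-- Uniqueness of the spectral factor: the roots of `D` lie in the left half plane and those of
`E(-s)` in the right one, so `D` is coprime to `E(-s)`. -/
lemma dvd_of_mul_comp_neg_X_eq {D E : ℂ[X]} (hD : ∀ z, D.eval z = 0 → z.re < 0)
    (hE : ∀ z, E.eval z = 0 → z.re < 0) (h : D * D.comp (-X) = E * E.comp (-X)) : D ∣ E := by
  refine IsCoprime.dvd_of_dvd_mul_right (z := E.comp (-X))
    (isCoprime_of_forall_eval fun z h1 h2 => ?_) ⟨_, h.symm⟩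
  have h3 := hE (-z) (by simpa using h2)
  have h4 := hD z h1
  simp at h3
  linarith

namespace IsCascadeData

/-- Stable cascade data with coprime second column are determined by the vacuum power spectrum. -/
lemma eq_of_powerSpectrum {k l : ℕ} {a b D a' b' D' : ℂ[X]} (h : IsCascadeData k a b D)
    (h' : IsCascadeData l a' b' D') (hc : IsCoprime (a.map (starRingEnd ℂ)) b)
    (hc' : IsCoprime (a'.map (starRingEnd ℂ)) b') (hD : ∀ z, D.eval z = 0 → z.re < 0)
    (hD' : ∀ z, D'.eval z = 0 → z.re < 0)
    (hΨ : ∀ i j : Fin 1 ⊕ Fin 1, D' * D'.comp (-X) *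
      (Sum.elim (fun _ => a) (fun _ => b.map (starRingEnd ℂ)) i *
        Sum.elim (fun _ => a.map (starRingEnd ℂ)) (fun _ => b) j) = D * D.comp (-X) *
      (Sum.elim (fun _ => a') (fun _ => b'.map (starRingEnd ℂ)) i *
        Sum.elim (fun _ => a'.map (starRingEnd ℂ)) (fun _ => b') j)) :
    a = a' ∧ b = b' ∧ D = D' := by
  have hconj : ∀ {a b : ℂ[X]}, IsCoprime (a.map (starRingEnd ℂ)) b →
      IsCoprime a (b.map (starRingEnd ℂ)) := by
    intro a b hab
    have := hab.map (mapRingHom (starRingEnd ℂ))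
    rwa [coe_mapRingHom, map_conj_map_conj] at this
  have e11 := hΨ (.inl 0) (.inl 0)
  have e12 := hΨ (.inl 0) (.inr 0)
  have e21 := hΨ (.inr 0) (.inl 0)
  have e22 := hΨ (.inr 0) (.inr 0)
  simp only [Sum.elim_inl, Sum.elim_inr] at e11 e12 e21 e22
  -- The four entries are products of one of `a`, `b#` with one of `a#`, `b`. Both pairs are
  -- coprime, so each can be cancelled from the divisibilities in turn.
  have key : ∀ {Δ Δ' a b : ℂ[X]}, IsCoprime (a.map (starRingEnd ℂ)) b →
      Δ ∣ Δ' * (a * a.map (starRingEnd ℂ)) → Δ ∣ Δ' * (a * b) →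
      Δ ∣ Δ' * (b.map (starRingEnd ℂ) * a.map (starRingEnd ℂ)) →
      Δ ∣ Δ' * (b.map (starRingEnd ℂ) * b) → Δ ∣ Δ' := by
    intro Δ Δ' a b hab h1 h2 h3 h4
    simp only [← mul_assoc] at h1 h2 h3 h4
    exact dvd_of_dvd_mul_of_isCoprime (hconj hab) (dvd_of_dvd_mul_of_isCoprime hab h1 h2)
      (dvd_of_dvd_mul_of_isCoprime hab h3 h4)
  have hΔ : D * D.comp (-X) = D' * D'.comp (-X) :=
    eq_of_monic_of_associated (h.monic_D.mul (monic_comp_neg_X h.monic_D h.natDegree_D))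
      (h'.monic_D.mul (monic_comp_neg_X h'.monic_D h'.natDegree_D))
      (associated_of_dvd_dvd
        (key hc ⟨_, e11⟩ ⟨_, e12⟩ ⟨_, e21⟩ ⟨_, e22⟩)
        (key hc' ⟨_, e11.symm⟩ ⟨_, e12.symm⟩ ⟨_, e21.symm⟩ ⟨_, e22.symm⟩))
  have hΔ0 : D * D.comp (-X) ≠ 0 :=
    (h.monic_D.mul (monic_comp_neg_X h.monic_D h.natDegree_D)).ne_zero
  rw [← hΔ] at e11 e12
  have f11 := mul_left_cancel₀ hΔ0 e11
  have f12 := mul_left_cancel₀ hΔ0 e12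
  -- From `a a# = a' a'#` and `a b = a' b'`, coprimality of `a#` and `b` gives `a' ∣ a`, and
  -- symmetrically `a ∣ a'`.
  have ha : a = a' := eq_of_monic_of_associated h.monic_a h'.monic_a (associated_of_dvd_dvd
    (dvd_of_dvd_mul_of_isCoprime hc' ⟨_, f11.symm⟩ ⟨_, f12.symm⟩)
    (dvd_of_dvd_mul_of_isCoprime hc ⟨_, f11⟩ ⟨_, f12⟩))
  rw [← ha] at f12
  exact ⟨ha, mul_left_cancel₀ h.monic_a.ne_zero f12,
    eq_of_monic_of_associated h.monic_D h'.monic_D (associated_of_dvd_dvd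
      (dvd_of_mul_comp_neg_X_eq hD hD' hΔ) (dvd_of_mul_comp_neg_X_eq hD' hD hΔ.symm))⟩

end IsCascadeData

namespace QLS

variable {n₁ n₂ : ℕ} {G₁ : QLS 1 n₁} {G₂ : QLS 1 n₂}

lemma eventually_notMem_spectrum_neg_conj {ι : Type*} [Fintype ι] [DecidableEq ι]
    (A : Matrix ι ι ℂ) : ∀ᶠ s in cofinite, -(starRingEnd ℂ s) ∉ spectrum ℂ A := by
  have hinj : Function.Injective fun s : ℂ => -(starRingEnd ℂ s) :=
    neg_injective.comp (starRingEnd ℂ).injective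
  exact hinj.tendsto_cofinite.eventually (eventually_notMem_spectrum A)

lemma SameTransferFunction.samePowerSpectrum {m : ℕ} {G₁ : QLS m n₁} {G₂ : QLS m n₂}
    (h : SameTransferFunction G₁ G₂) (V : Matrix (Fin m ⊕ Fin m) (Fin m ⊕ Fin m) ℂ) :
    SamePowerSpectrum V G₁ G₂ := by
  intro s h1 h2 h3 h4
  rw [powerSpectrum, powerSpectrum, h s h1 h3, h _ h2 h4]

lemma SamePowerSpectrum.sameTransferFunction (hstable₁ : G₁.IsStable) (hstable₂ : G₂.IsStable)
    (hmin₁ : G₁.IsGloballyMinimal (Vvac (Fin 1))) (hmin₂ : G₂.IsGloballyMinimal (Vvac (Fin 1)))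
    (hgen₁ : G₁.HasCascadeRealisation) (hgen₂ : G₂.HasCascadeRealisation)
    (hΨ : SamePowerSpectrum (Vvac (Fin 1)) G₁ G₂) : SameTransferFunction G₁ G₂ := by
  obtain ⟨a₁, b₁, D₁, h₁, hE₁⟩ := hgen₁.exists_isCascadeData
  obtain ⟨a₂, b₂, D₂, h₂, hE₂⟩ := hgen₂.exists_isCascadeData
  obtain ⟨rfl, rfl, rfl⟩ := h₁.eq_of_powerSpectrum h₂ (hmin₁.isCoprime hstable₁ h₁ hE₁)
    (hmin₂.isCoprime hstable₂ h₂ hE₂) (fun z => hmin₁.re_neg_of_isRoot hstable₁ h₁ hE₁)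
    (fun z => hmin₂.re_neg_of_isRoot hstable₂ h₂ hE₂) (by
      intro i j
      refine eq_of_eventually_eval_eq ?_
      filter_upwards [eventually_notMem_spectrum G₁.A, eventually_notMem_spectrum G₂.A,
        eventually_notMem_spectrum_neg_conj G₁.A, eventually_notMem_spectrum_neg_conj G₂.A]
        with s s1 s2 s3 s4
      rw [eval_mul, ← eval_mul_powerSpectrum h₁ hE₁ s1 s3, eval_mul (p := D₁ * _),
        ← eval_mul_powerSpectrum h₂ hE₂ s2 s4, hΨ s s1 s3 s2 s4]
      ring)
  intro s hs1 hs2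
  refine eq_of_eventuallyEq_cofinite (continuousAt_transferFunction G₁ hs1)
    (continuousAt_transferFunction G₂ hs2) ?_
  have hroot : {z | D₁.IsRoot z}.Finite := finite_setOfPred_isRoot h₁.monic_D.ne_zero
  filter_upwards [eventually_notMem_spectrum G₁.A, eventually_notMem_spectrum G₂.A,
    hroot.compl_mem_cofinite] with z z1 z2 z3
  exact smul_right_injective _ z3 ((hE₁ z z1).trans (hE₂ z z2).symm)

end QLS

end Identification

end QuantumLinear

end

theorem mainTheorem6 {n₁ n₂ : ℕ}
    (G₁ : QuantumLinear.QLS 1 n₁) (G₂ : QuantumLinear.QLS 1 n₂)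
    (hstable₁ : G₁.IsStable) (hstable₂ : G₂.IsStable)
    (hmin₁ : G₁.IsGloballyMinimal (QuantumLinear.Vvac (Fin 1)))
    (hmin₂ : G₂.IsGloballyMinimal (QuantumLinear.Vvac (Fin 1)))
    (hgen₁ : G₁.HasCascadeRealisation) (hgen₂ : G₂.HasCascadeRealisation) :
    QuantumLinear.QLS.SamePowerSpectrum (QuantumLinear.Vvac (Fin 1)) G₁ G₂ ↔
      QuantumLinear.QLS.SameTransferFunction G₁ G₂ := by
  refine ⟨fun h => ?_, fun h => h.samePowerSpectrum _⟩
  exact QuantumLinear.QLS.SamePowerSpectrum.sameTransferFunction hstable₁ hstable₂ hmin₁ hmin₂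
    hgen₁ hgen₂ h
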